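/- A permutation is a finite word of positive integers without repeated letters; $S_n$ is the set of permutations of $\{1,\dots,n\}$. West's stack-sorting map $s$ sends the empty word to itself and a permutation $LnR$ with largest entry $n$ to $s(L)\,s(R)\,n$. A permutation $\pi$ is uniquely sorted if $|s^{-1}(\pi)|=1$. The normalization of a permutation replaces its $i$-th smallest entry by $i$ for every $i$; a permutation contains a pattern $\tau$ if one of its subwords has the same normalization as $\tau$, and otherwise avoids $\tau$. Let $\mathcal U_{n}(312,1342)$ be the set of uniquely sorted permutations in $S_n$ that avoid $312$ and $1342$. Let $\mathrm{NC}_k$ be the lattice of noncrossing partitions of $\{1,\dots,k\}$ ordered by refinement ($\mathrm{NC}_0$ has one element), and let $\mathrm{Int}(\mathrm{NC}_k)$ be the set of pairs $(\rho,\kappa)\in \mathrm{NC}_k^2$ with $\rho\le\kappa$. A descent of $\pi=\pi_1\cdots\pi_n$ is an index $i\in\{1,\dots,n-1\}$ with $\pi_i>\pi_{i+1}$. A hook of $\pi$ joins a southwest endpoint $(i,\pi_i)$ to a northeast endpoint $(j,\pi_j)$, where $i<j$ and $\pi_i<\pi_j$; a point $(r,\pi_r)$ lies weakly below it if $r=j$,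 or if $i<r<j$ and $\pi_r<\pi_j$. Let $d_1<\dots<d_m$ be the descents of $\pi$. The canonical hook configuration of $\pi$ consists of hooks $H_m,\dots,H_1$, chosen in this order, where $H_\ell$ has southwest endpoint $(d_\ell,\pi_{d_\ell})$ and its northeast endpoint is the leftmost point above and to the right of $(d_\ell,\pi_{d_\ell})$ that does not lie weakly below any of $H_m,\dots,H_{\ell+1}$; it exists if all these points exist. A permutation $\pi\in\mathcal U_{2k+1}(312,1342)$ generates $\widetilde\pi\in\mathcal U_{2k+3}(312,1342)$ if $\widetilde\pi$ has a canonical hook configuration in which the highest point of the plot of $\widetilde\pi$ is the northeast endpoint of a hook $H$, and $\pi$ is the normalization of the permutation obtained from $\widetilde\pi$ by deleting this highest point and the point immediately to the right of the southwest endpoint of $H$. An interval $(\rho,\kappa)\in\mathrm{Int}(\mathrm{NC}_k)$ generates $(\widetilde\rho,\widetilde\kappa)\in\mathrm{Int}(\mathrm{NC}_{k+1})$ if $\rho$ and $\kappa$ are obtained from $\widetilde\rho$ and $\widetilde\kappa$, respectively, by removing the number $k+1$ from its block (and discarding this block if it becomes empty). Both $\pi\in\mathcal U_{2k+1}(312,1342)$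 and $(\rho,\kappa)\in\mathrm{Int}(\mathrm{NC}_k)$ are said to have size $k$, and the label of an object is the number of objects that it generates. Theorem. There are bijections $$\Upsilon_k:\mathcal U_{2k+1}(312,1342)\to\mathrm{Int}(\mathrm{NC}_k)\qquad(k\ge 0)$$ such that, for all $k\ge0$, $\pi\in\mathcal U_{2k+1}(312,1342)$ and $\widetilde\pi\in\mathcal U_{2k+3}(312,1342)$, $\pi$ generates $\widetilde\pi$ if and only if $\Upsilon_k(\pi)$ generates $\Upsilon_{k+1}(\widetilde\pi)$. Moreover, both classes have the generating tree with axiom $(3)$ and rule $(m)\leadsto(3)(4)\cdots(m+2)$: in each of the two classes there are finitely many objects of each size, every object of size $k+1\ge 2$ is generated by a unique object of size $k$, there is exactly one object of size $1$ and its label is $3$, and for every object of size at least $1$ with label $m$ the labels of the objects that it generates are $3,4,\dots,m+2$, each occurring exactly once. -/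

import Mathlib

namespace CatalanIntervals

/-! ### Permutations as words -/

/-- West's stack-sorting map: the empty word is sent to itself, and a word `L n R` with largest
letter `n` is sent to `s(L) s(R) n`. -/
def stackSort (w : List ℕ) : List ℕ :=
  match _h : w.max? with
  | none => []
  | some n =>
      stackSort (w.takeWhile (fun x => decide (x ≠ n))) ++
        stackSort (w.dropWhile (fun x => decide (x ≠ n))).tail ++ [n]
termination_by w.length
decreasing_by
  · have hn : n ∈ w := List.max?_mem _h
    have h1 : w.takeWhile (fun x => decide (x ≠ n)) ++
        w.dropWhile (fun x => decide (x ≠ n)) = w := List.takeWhile_append_dropWhile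
    have h2 : w.dropWhile (fun x => decide (x ≠ n)) ≠ [] := by
      intro h3
      have := List.dropWhile_eq_nil_iff.mp h3 n hn
      simp at this
    have h4 := congrArg List.length h1
    have h5 := List.length_pos_iff.mpr h2
    rw [List.length_append] at h4
    omega
  · have hn : n ∈ w := List.max?_mem _h
    have h6 : 0 < w.length := List.length_pos_of_mem hn
    have h7 : (w.dropWhile (fun x => decide (x ≠ n))).length ≤ w.length :=
      (List.dropWhile_suffix _).length_le
    rw [List.length_tail]
    omega

/-- A permutation: a finite word of positive integers without repeated letters. -/
def IsPermWord (w : List ℕ) : Prop :=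
  w.Nodup ∧ ∀ x ∈ w, 0 < x

/-- `S_n`, the set of permutations of `{1, …, n}` in one-line notation. -/
def symm (n : ℕ) : Set (List ℕ) :=
  {w | w.Perm (List.range' 1 n)}

/-- The fertility of a permutation: its number of preimages under the stack-sorting map. -/
noncomputable def fertility (w : List ℕ) : ℕ :=
  Set.ncard {v : List ℕ | IsPermWord v ∧ stackSort v = w}

/-- The normalization of a permutation: its `i`-th smallest letter is replaced by `i`. -/
def normalize (w : List ℕ) : List ℕ :=
  w.map (fun x => w.countP (fun y => decide (y ≤ x)))

/-- `w` contains the pattern `p`: some subword of `w` has the same relative order as `p`. -/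
def ContainsPattern (w p : List ℕ) : Prop :=
  ∃ v : List ℕ, v.Sublist w ∧ normalize v = normalize p

/-- `U_n(T)`: the uniquely sorted permutations in `S_n` (those of fertility `1`) that avoid all
the patterns in `T`. -/
def uniquelySortedAvoiding (n : ℕ) (T : Set (List ℕ)) : Set (List ℕ) :=
  {w | w ∈ symm n ∧ fertility w = 1 ∧ ∀ p ∈ T, ¬ ContainsPattern w p}

/-! ### Canonical hook configurations

Positions in a word are counted from `0`; the point of the plot at position `i` has height
`w.getD i 0`. -/

/-- `i` is (the position of) a descent of `w`. -/
def IsDescent (w : List ℕ) (i : ℕ) : Prop :=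
  i + 1 < w.length ∧ w.getD (i + 1) 0 < w.getD i 0

/-- The point at position `r` lies weakly below the hook with southwest endpoint at position `i`
and northeast endpoint at position `j`. -/
def WeaklyBelow (w : List ℕ) (r i j : ℕ) : Prop :=
  (i < r ∧ r < j ∧ w.getD r 0 < w.getD j 0) ∨ r = j

/-- `N` describes the canonical hook configuration of `w`: for every descent `d` there is one hook,
from position `d` to position `N d`, and `N d` is the leftmost point above and to the right of the
point at `d` that does not lie weakly below any of the hooks of the descents to the right
of `d`. The values of `N` at positions that are not descents play no role. -/
def IsCanonicalHookConfiguration (w : List ℕ) (N : ℕ → ℕ) : Prop :=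
  ∀ d, IsDescent w d →
    IsLeast {j | d < j ∧ j < w.length ∧ w.getD d 0 < w.getD j 0 ∧
      ∀ d', IsDescent w d' → d < d' → ¬ WeaklyBelow w j d' (N d')} (N d)

/-- `π` is obtained from `π'` by removing the highest point of the plot of `π'`, which is the
northeast endpoint of a hook of the canonical hook configuration of `π'`, and its partner (the point
immediately to the right of the southwest endpoint of that hook), and then normalizing. -/
def WordGenerates (π π' : List ℕ) : Prop :=
  ∃ (N : ℕ → ℕ) (d : ℕ), IsCanonicalHookConfiguration π' N ∧ IsDescent π' d ∧
    (∀ x ∈ π', x ≤ π'.getD (N d) 0) ∧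
    π = normalize ((π'.eraseIdx (N d)).eraseIdx (d + 1))

/-- `U_{2k+1}(312, 1342)`. -/
abbrev U (k : ℕ) : Type :=
  uniquelySortedAvoiding (2 * k + 1) {[3, 1, 2], [1, 3, 4, 2]}

/-- The relation "`π` generates `π'`" between `U_{2k+1}(312, 1342)` and
`U_{2k+3}(312, 1342)`. -/
def permGenerates (k : ℕ) (π : U k) (π' : U (k + 1)) : Prop :=
  WordGenerates π.1 π'.1

/-! ### Noncrossing partitions -/

/-- A set partition is noncrossing if no two distinct blocks of it form a crossing. -/
def IsNoncrossing {s : Finset ℕ} (P : Finpartition s) : Prop :=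
  ∀ B ∈ P.parts, ∀ B' ∈ P.parts, B ≠ B' →
    ¬ ∃ a ∈ B, ∃ c ∈ B, ∃ b ∈ B', ∃ d ∈ B',
      (a < b ∧ b < c ∧ c < d) ∨ (b < a ∧ c < b ∧ d < c)

/-- `NC_k`: the noncrossing partitions of `{1, …, k}`, ordered by refinement. -/
abbrev NC (k : ℕ) : Type :=
  {P : Finpartition (Finset.Icc 1 k) // IsNoncrossing P}

/-- `ρ` is the partition obtained from `ρ'` by removing `k + 1` from its block. -/
def IsRestriction {k : ℕ} (ρ : NC k) (ρ' : NC (k + 1)) : Prop :=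
  ρ.1.parts = (ρ'.1.parts.image (fun B => B.erase (k + 1))).erase ∅

/-- The intervals of `NC_k`: pairs `(ρ, κ)` with `ρ ≤ κ`. -/
abbrev IntNC (k : ℕ) : Type :=
  NonemptyInterval (NC k)

/-- The relation "`(ρ, κ)` generates `(ρ', κ')`" between the intervals of `NC_k` and those of
`NC_{k+1}`. -/
def intervalGenerates (k : ℕ) (I : IntNC k) (I' : IntNC (k + 1)) : Prop :=
  IsRestriction I.fst I'.fst ∧ IsRestriction I.snd I'.snd

/-! ### Generating trees -/

/-- The label of an object: the number of objects that it generates. -/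
noncomputable def label {X : ℕ → Type} (gen : ∀ n, X n → X (n + 1) → Prop) (n : ℕ) (x : X n) : ℕ :=
  Nat.card {y : X (n + 1) // gen n x y}

/-- The class `X` (with `X n` the finite set of objects of size `n`), with the generation scheme
`gen`, has the generating tree in which the objects of size `1` have the labels `start` and an
object with label `m` generates objects with the labels `rule m`, with multiplicities. -/
structure HasGeneratingTree (X : ℕ → Type) (gen : ∀ n, X n → X (n + 1) → Prop)
    (start : Multiset ℕ) (rule : ℕ → Multiset ℕ) : Prop where
  finite_size : ∀ n, Finite (X n)
  unique_parent : ∀ n, 1 ≤ n → ∀ y : X (n + 1), ∃! x : X n, gen n x y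
  start_labels : ∀ l : ℕ, Nat.card {x : X 1 // label gen 1 x = l} = start.count l
  child_labels : ∀ n, 1 ≤ n → ∀ (x : X n) (l : ℕ),
    Nat.card {y : X (n + 1) // gen n x y ∧ label gen (n + 1) y = l} =
      (rule (label gen n x)).count l

end CatalanIntervals

namespace CatalanIntervals

/-! Both classes are realizations of one labelled tree in which an object is determined by its
parent and its label, so matching labels size by size yields the bijections
(`IsLabelTree.exists_equiv`). The unique object of size `0` has label `1`, and the rule sends `(1)`
to `(3)`, so size `0` fits the same pattern.

The rule has one source, `IsLabelTree.of_sites`: the children of an object correspond to a finite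
linearly ordered set of sites, and the child at site `s` has three sites more than there are sites
below `s`.

Intervals: `k + 1` can join a block that is not nested under another one, named by its minimum, or
form a new block, named `k + 1`. A site of `(ρ, κ)` is a pair `(b, a)` with `b` for `κ` and `a` for
`ρ`; refinement survives iff `a = k + 1` or `a` lies in the `κ`-block of `b`. Joining the block of
`b` covers the later outer blocks, so exactly the lexicographically smaller sites survive, and `(b,
a)`, `(b, k + 2)`, `(k + 2, k + 2)` are added (`card_intervalSites_of_isExtension`).

Permutations: a nonempty sorted word with `d` descents has length at least `2d + 1`, while a
nonempty prefix of a tight word has length at most `2d + 1`, where `d` counts its own descents. The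
two bounds force a unique cut of a tight word, so for permutations of positive length tightness is
the same as fertility `1`. In a tight word `α a b β m` the hook ending at `m` starts at `a`; the
parent is therefore the normalization of `α a β` (`wordGenerates_join_iff`). Avoidance of `312` and
`1342` means, for the deleted letter, that letters of `β` below `a` are below `b` and that `α` lies
entirely on one side of `b`. Hence a child is given by a balanced prefix `α a` and a binary choice:
`b` just below `a`, or `b` below the whole prefix. For a prefix of one letter these coincide, so
only the first is counted. The balanced prefixes of the child are those of `α a` and the whole word,
so again the lexicographically smaller sites survive and three are added (`card_permSites_join`). -/

/-! ### Generating trees in which an object with label `m` has children labelled `3, …, m + 2` -/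

/-- The class `X` has one object of size `0`, every other object has a unique parent, and the labels
of the children of an object with label `m` are `3, …, m + 2`, each occurring once. -/
structure IsLabelTree (X : ℕ → Type) (gen : ∀ n, X n → X (n + 1) → Prop) : Prop where
  root : ∃ x₀ : X 0, (∀ x, x = x₀) ∧ label gen 0 x₀ = 1
  parent : ∀ n (y : X (n + 1)), ∃! x : X n, gen n x y
  bijOn : ∀ n (x : X n), Set.BijOn (label gen (n + 1)) {y | gen n x y}
    (Finset.Icc 3 (label gen n x + 2) : Finset ℕ)

/-- As `s` runs through `m` ordered sites, the number of sites below `s` takes each of the values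
`0, …, m - 1` once, and adding `3` gives `3, …, m + 2`. -/
theorem IsLabelTree.of_sites {X : ℕ → Type} {gen : ∀ n, X n → X (n + 1) → Prop}
    {σ : Type*} [LinearOrder σ] (S : ∀ n, X n → Finset σ)
    (root : ∃ x₀ : X 0, (∀ x, x = x₀) ∧ (S 0 x₀).card = 1)
    (parent : ∀ n (y : X (n + 1)), ∃! x : X n, gen n x y)
    (child : ∀ n (x : X n), ∃ c : S n x → X (n + 1), Function.Injective c ∧
      (∀ y, gen n x y ↔ ∃ s, c s = y) ∧
      ∀ s : S n x, (S (n + 1) (c s)).card = 3 + ((S n x).filter (· < s.1)).card) :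
    IsLabelTree X gen := by
  have hlabel : ∀ n (x : X n), label gen n x = (S n x).card := by
    intro n x
    obtain ⟨c, hc, hr, -⟩ := child n x
    have e : S n x ≃ {y // gen n x y} :=
      Equiv.ofBijective (fun s => ⟨c s, (hr _).2 ⟨s, rfl⟩⟩)
        ⟨fun s t h => hc (congrArg Subtype.val h), fun ⟨y, hy⟩ => by
          obtain ⟨s, hs⟩ := (hr y).1 hy
          exact ⟨s, Subtype.ext hs⟩⟩
    rw [label, ← Nat.card_congr e, Nat.card_eq_fintype_card, Fintype.card_coe]
  refine ⟨?_, parent, ?_⟩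
  · obtain ⟨x₀, h, h1⟩ := root
    exact ⟨x₀, h, by rw [hlabel, h1]⟩
  intro n x
  obtain ⟨c, hc, hr, hcard⟩ := child n x
  have hlt : ∀ s t : S n x, s < t →
      ((S n x).filter (· < s.1)).card < ((S n x).filter (· < t.1)).card := by
    intro s t hst
    apply Finset.card_lt_card
    rw [Finset.ssubset_iff_of_subset]
    · exact ⟨s.1, by simp [s.2, Subtype.coe_lt_coe.2 hst], by simp⟩
    · intro u hu
      rw [Finset.mem_filter] at hu ⊢
      exact ⟨hu.1, hu.2.trans hst⟩
  have hinj : Set.InjOn (label gen (n + 1)) {y | gen n x y} := by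
    intro y hy z hz hyz
    obtain ⟨s, rfl⟩ := (hr y).1 hy
    obtain ⟨t, rfl⟩ := (hr z).1 hz
    rw [hlabel, hlabel, hcard, hcard] at hyz
    rcases lt_trichotomy s t with h | h | h
    · have := hlt _ _ h; omega
    · rw [h]
    · have := hlt _ _ h; omega
  have hmaps : ∀ s, label gen (n + 1) (c s) ∈ Finset.Icc 3 (label gen n x + 2) := by
    intro s
    rw [hlabel, hlabel, hcard, Finset.mem_Icc]
    have : ((S n x).filter (· < s.1)).card < (S n x).card := by
      apply Finset.card_lt_card
      rw [Finset.ssubset_iff_of_subset (Finset.filter_subset _ _)]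
      exact ⟨s.1, s.2, by simp⟩
    omega
  refine ⟨?_, hinj, ?_⟩
  · intro y hy
    obtain ⟨s, rfl⟩ := (hr y).1 hy
    exact hmaps s
  · have hi : Function.Injective (fun s => label gen (n + 1) (c s)) := fun s t h =>
      hc (hinj ((hr _).2 ⟨s, rfl⟩) ((hr _).2 ⟨t, rfl⟩) h)
    have himg : Finset.univ.image (fun s => label gen (n + 1) (c s)) =
        Finset.Icc 3 (label gen n x + 2) := by
      apply Finset.eq_of_subset_of_card_le
      · intro l hl
        obtain ⟨s, -, rfl⟩ := Finset.mem_image.1 hl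
        exact hmaps s
      · rw [Finset.card_image_of_injective _ hi, Finset.card_univ, Fintype.card_coe, Nat.card_Icc,
          hlabel]
        omega
    intro l hl
    rw [← himg] at hl
    obtain ⟨s, -, rfl⟩ := Finset.mem_image.1 hl
    exact ⟨c s, (hr _).2 ⟨s, rfl⟩, rfl⟩

namespace IsLabelTree

variable {X Y : ℕ → Type} {gen : ∀ n, X n → X (n + 1) → Prop} {gen' : ∀ n, Y n → Y (n + 1) → Prop}

theorem exists_child (h : IsLabelTree X gen) {n : ℕ} (x : X n) {l : ℕ}
    (hl : l ∈ Finset.Icc 3 (label gen n x + 2)) :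
    ∃! y, gen n x y ∧ label gen (n + 1) y = l := by
  obtain ⟨y, hy, hyl⟩ := (h.bijOn n x).surjOn hl
  exact ⟨y, ⟨hy, hyl⟩, fun z hz => (h.bijOn n x).injOn hz.1 hy (hz.2.trans hyl.symm)⟩

theorem label_mem (h : IsLabelTree X gen) {n : ℕ} {x : X n} {y : X (n + 1)} (hxy : gen n x y) :
    label gen (n + 1) y ∈ Finset.Icc 3 (label gen n x + 2) :=
  (h.bijOn n x).mapsTo hxy

theorem finite (h : IsLabelTree X gen) (n : ℕ) : Finite (X n) := by
  induction n with
  | zero =>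
    obtain ⟨x₀, hx, -⟩ := h.root
    have : Subsingleton (X 0) := ⟨fun a b => (hx a).trans (hx b).symm⟩
    infer_instance
  | succ n ih =>
    have hfin : (Set.univ : Set (X (n + 1))) ⊆ ⋃ x : X n, {y | gen n x y} := by
      intro y _
      obtain ⟨x, hx, -⟩ := h.parent n y
      exact Set.mem_iUnion.2 ⟨x, hx⟩
    have : (⋃ x : X n, {y | gen n x y}).Finite := Set.finite_iUnion fun x =>
      Set.Finite.of_finite_image ((Finset.finite_toSet _).subset (h.bijOn n x).mapsTo.image_subset)
        (h.bijOn n x).injOn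
    exact Set.finite_univ_iff.1 (this.subset hfin)

theorem card_children (h : IsLabelTree X gen) {n : ℕ} (x : X n) (l : ℕ) :
    Nat.card {y : X (n + 1) // gen n x y ∧ label gen (n + 1) y = l} =
      ((Finset.Icc 3 (label gen n x + 2)).val).count l := by
  by_cases hl : l ∈ Finset.Icc 3 (label gen n x + 2)
  · obtain ⟨y, hy, hu⟩ := h.exists_child x hl
    rw [Multiset.count_eq_one_of_mem (Finset.nodup _) hl, Nat.card_eq_one_iff_unique]
    exact ⟨⟨fun a b => Subtype.ext ((hu _ a.2).trans (hu _ b.2).symm)⟩, ⟨⟨y, hy⟩⟩⟩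
  · rw [Multiset.count_eq_zero_of_notMem hl, Nat.card_eq_zero]
    exact Or.inl ⟨fun y => hl (y.2.2 ▸ h.label_mem y.2.1)⟩

theorem hasGeneratingTree (h : IsLabelTree X gen) :
    HasGeneratingTree X gen {3} (fun m => (Finset.Icc 3 (m + 2)).val) where
  finite_size := h.finite
  unique_parent n _ := h.parent n
  start_labels l := by
    obtain ⟨x₀, hx, h1⟩ := h.root
    have hc := h.card_children x₀ l
    rw [h1] at hc
    -- Every object of size `1` is a child of the root, so the labels in size `1` are those of the
    -- children of an object with label `1`.
    have hgen : ∀ y, gen 0 x₀ y := fun y => by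
      obtain ⟨x, hxy, -⟩ := h.parent 0 y
      rwa [hx x] at hxy
    simpa [hgen] using hc
  child_labels n _ := h.card_children

/-- An object goes to the child of the image of its parent that carries the same label; equal labels
of the parents guarantee that this child exists. -/
theorem exists_lift (hX : IsLabelTree X gen) (hY : IsLabelTree Y gen') (n : ℕ) (e : X n ≃ Y n)
    (he : ∀ x, label gen' n (e x) = label gen n x) :
    ∃ f : X (n + 1) → Y (n + 1), ∀ y, label gen' (n + 1) (f y) = label gen (n + 1) y ∧
      ∀ x, gen n x y ↔ gen' n (e x) (f y) := by
  have : ∀ y : X (n + 1), ∃ z : Y (n + 1), label gen' (n + 1) z = label gen (n + 1) y ∧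
      ∀ x, gen n x y ↔ gen' n (e x) z := by
    intro y
    obtain ⟨x, hx, hu⟩ := hX.parent n y
    obtain ⟨z, hz, -⟩ := hY.exists_child (e x) (l := label gen (n + 1) y)
      (by rw [he]; exact hX.label_mem hx)
    refine ⟨z, hz.2, fun x' => ⟨fun h => hu x' h ▸ hz.1, fun h => ?_⟩⟩
    have := (hY.parent n z).unique h hz.1
    rwa [e.injective this]
  choose f hf using this
  exact ⟨f, hf⟩

/-- `g (f y)` and `y` have the same parent and the same label. -/
theorem lift_comp (hX : IsLabelTree X gen) (n : ℕ) {e : X n → Y n} {e' : Y n → X n}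
    (hee : ∀ x, e' (e x) = x) {f : X (n + 1) → Y (n + 1)} {g : Y (n + 1) → X (n + 1)}
    (hf : ∀ y, label gen' (n + 1) (f y) = label gen (n + 1) y ∧ ∀ x, gen n x y ↔ gen' n (e x) (f y))
    (hg : ∀ z, label gen (n + 1) (g z) = label gen' (n + 1) z ∧
      ∀ x, gen' n x z ↔ gen n (e' x) (g z)) (y : X (n + 1)) : g (f y) = y := by
  obtain ⟨x, hx, -⟩ := hX.parent n y
  have h1 := ((hg (f y)).2 (e x)).1 (((hf y).2 x).1 hx)
  rw [hee] at h1
  exact (hX.bijOn n x).injOn h1 hx ((hg _).1.trans (hf _).1)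

theorem exists_equiv_succ (hX : IsLabelTree X gen) (hY : IsLabelTree Y gen') (n : ℕ) (e : X n ≃ Y n)
    (he : ∀ x, label gen' n (e x) = label gen n x) :
    ∃ f : X (n + 1) ≃ Y (n + 1), (∀ y, label gen' (n + 1) (f y) = label gen (n + 1) y) ∧
      ∀ x y, gen n x y ↔ gen' n (e x) (f y) := by
  obtain ⟨f, hf⟩ := hX.exists_lift hY n e he
  obtain ⟨g, hg⟩ := hY.exists_lift hX n e.symm (fun y => by rw [← he, e.apply_symm_apply])
  exact ⟨⟨f, g, hX.lift_comp n e.symm_apply_apply hf hg, hY.lift_comp n e.apply_symm_apply hg hf⟩,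
    fun y => (hf y).1, fun x y => (hf y).2 x⟩

/-- Two classes with this generating tree are isomorphic. -/
theorem exists_equiv (hX : IsLabelTree X gen) (hY : IsLabelTree Y gen') :
    ∃ e : ∀ n, X n ≃ Y n, ∀ n x y, gen n x y ↔ gen' n (e n x) (e (n + 1) y) := by
  obtain ⟨x₀, hx, hx1⟩ := hX.root
  obtain ⟨y₀, hy, hy1⟩ := hY.root
  let e₀ : X 0 ≃ Y 0 := ⟨fun _ => y₀, fun _ => x₀, fun x => (hx x).symm, fun y => (hy y).symm⟩
  choose s hs using hX.exists_equiv_succ hY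
  let E : ∀ n, {e : X n ≃ Y n // ∀ x, label gen' n (e x) = label gen n x} := fun n =>
    Nat.rec ⟨e₀, fun x => by rw [hx x, hx1]; exact hy1⟩
      (fun n e => ⟨s n e.1 e.2, (hs n e.1 e.2).1⟩) n
  exact ⟨fun n => (E n).1, fun n => (hs n (E n).1 (E n).2).2⟩

end IsLabelTree

/-! ### Noncrossing partitions through their equivalence relations -/

/-- `x` and `y` lie in the same block of `P`. -/
def SameBlock {s : Finset ℕ} (P : Finpartition s) (x y : ℕ) : Prop :=
  ∃ B ∈ P.parts, x ∈ B ∧ y ∈ B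

namespace SameBlock

variable {s : Finset ℕ} {P Q : Finpartition s} {x y z : ℕ}

theorem refl (P : Finpartition s) (hx : x ∈ s) : SameBlock P x x := by
  obtain ⟨B, hB, hxB⟩ := P.exists_mem hx
  exact ⟨B, hB, hxB, hxB⟩

theorem symm (h : SameBlock P x y) : SameBlock P y x := by
  obtain ⟨B, hB, hx, hy⟩ := h
  exact ⟨B, hB, hy, hx⟩

theorem trans (h : SameBlock P x y) (h' : SameBlock P y z) : SameBlock P x z := by
  obtain ⟨B, hB, hx, hy⟩ := h
  obtain ⟨C, hC, hy', hz⟩ := h'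
  obtain rfl := P.eq_of_mem_parts hB hC hy hy'
  exact ⟨B, hB, hx, hz⟩

theorem left_mem (h : SameBlock P x y) : x ∈ s := by
  obtain ⟨B, hB, hx, -⟩ := h
  exact P.subset hB hx

theorem right_mem (h : SameBlock P x y) : y ∈ s := h.symm.left_mem

theorem mem_iff {B : Finset ℕ} (hB : B ∈ P.parts) (hx : x ∈ B) : y ∈ B ↔ SameBlock P x y := by
  refine ⟨fun hy => ⟨B, hB, hx, hy⟩, fun ⟨C, hC, hx', hy⟩ => ?_⟩
  rwa [P.eq_of_mem_parts hB hC hx hx']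

theorem le_iff : P ≤ Q ↔ ∀ x y, SameBlock P x y → SameBlock Q x y := by
  constructor
  · rintro h x y ⟨B, hB, hx, hy⟩
    obtain ⟨C, hC, hBC⟩ := h hB
    exact ⟨C, hC, hBC hx, hBC hy⟩
  · intro h B hB
    obtain ⟨x, hx⟩ := P.nonempty_of_mem_parts hB
    obtain ⟨C, hC, hxC⟩ := Q.exists_mem (P.subset hB hx)
    exact ⟨C, hC, fun y hy => (mem_iff hC hxC).2 (h x y ⟨B, hB, hx, hy⟩)⟩

theorem ext (h : ∀ x y, SameBlock P x y ↔ SameBlock Q x y) : P = Q :=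
  le_antisymm (le_iff.2 fun x y => (h x y).1) (le_iff.2 fun x y => (h x y).2)

theorem exists_finpartition (s : Finset ℕ) (r : ℕ → ℕ → Prop) (hrefl : ∀ x ∈ s, r x x)
    (hsymm : ∀ x y, r x y → r y x) (htrans : ∀ x y z, r x y → r y z → r x z)
    (hmem : ∀ x y, r x y → x ∈ s) : ∃ P : Finpartition s, ∀ x y, SameBlock P x y ↔ r x y := by
  classical
  let t : Setoid ℕ := ⟨fun x y => x = y ∨ r x y, fun x => Or.inl rfl,
    fun {x y} h => h.elim (fun h => Or.inl h.symm) (fun h => Or.inr (hsymm _ _ h)), by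
      rintro x y z (rfl | h) (rfl | h')
      · exact Or.inl rfl
      · exact Or.inr h'
      · exact Or.inr h
      · exact Or.inr (htrans _ _ _ h h')⟩
  refine ⟨Finpartition.ofSetSetoid t s, fun x y => ?_⟩
  have h := Finpartition.mem_part_ofSetSetoid_iff_rel (s := t) s (a := x) (b := y)
  rw [Finpartition.mem_part_iff_exists] at h
  constructor
  · rintro ⟨B, hB, hx, hy⟩
    obtain ⟨h1, h2, h3⟩ := h.1 ⟨B, hB, hy, hx⟩
    rcases h3 with rfl | h3
    · exact hrefl _ h1
    · exact h3
  · intro hr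
    obtain ⟨B, hB, hy, hx⟩ := h.2 ⟨hmem _ _ hr, hmem _ _ (hsymm _ _ hr), Or.inr hr⟩
    exact ⟨B, hB, hx, hy⟩

end SameBlock

/-- The second alternative in `IsNoncrossing` is the first one with the two blocks interchanged, so
a single order of the four points suffices. -/
theorem isNoncrossing_iff {s : Finset ℕ} {P : Finpartition s} :
    IsNoncrossing P ↔ ∀ a b c d, a < b → b < c → c < d → SameBlock P a c → SameBlock P b d →
      SameBlock P a b := by
  constructor
  · rintro h a b c d hab hbc hcd ⟨B, hB, ha, hc⟩ ⟨C, hC, hb, hd⟩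
    by_cases hBC : B = C
    · exact ⟨B, hB, ha, hBC ▸ hb⟩
    · exact absurd ⟨a, ha, c, hc, b, hb, d, hd, Or.inl ⟨hab, hbc, hcd⟩⟩ (h B hB C hC hBC)
  · rintro h B hB C hC hBC ⟨a, ha, c, hc, b, hb, d, hd, ⟨h1, h2, h3⟩ | ⟨h1, h2, h3⟩⟩
    · obtain ⟨D, hD, haD, hbD⟩ := h a b c d h1 h2 h3 ⟨B, hB, ha, hc⟩ ⟨C, hC, hb, hd⟩
      exact hBC ((P.eq_of_mem_parts hB hD ha haD).trans (P.eq_of_mem_parts hC hD hb hbD).symm)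
    · obtain ⟨D, hD, hdD, hcD⟩ := h d c b a h3 h2 h1 ⟨C, hC, hd, hb⟩ ⟨B, hB, hc, ha⟩
      exact hBC ((P.eq_of_mem_parts hB hD hc hcD).trans (P.eq_of_mem_parts hC hD hd hdD).symm)

variable {k : ℕ}

theorem NC.ext {P Q : NC k} (h : ∀ x y, SameBlock P.1 x y ↔ SameBlock Q.1 x y) : P = Q :=
  Subtype.ext (SameBlock.ext h)

/-- Replaces an equality of families of blocks by a condition on pairs, in which the discarded empty
block plays no role. -/
theorem isRestriction_iff {P : NC k} {P' : NC (k + 1)} :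
    IsRestriction P P' ↔ ∀ x y, SameBlock P.1 x y ↔ x ≤ k ∧ y ≤ k ∧ SameBlock P'.1 x y := by
  have key : ∀ B, B ∈ (P'.1.parts.image (fun B => B.erase (k + 1))).erase ∅ ↔
      B ≠ ∅ ∧ ∃ C ∈ P'.1.parts, C.erase (k + 1) = B := by
    intro B
    rw [Finset.mem_erase, Finset.mem_image]
  constructor
  · intro h x y
    rw [IsRestriction] at h
    constructor
    · rintro ⟨B, hB, hx, hy⟩
      have hx' := Finset.mem_Icc.1 (P.1.subset hB hx)
      have hy' := Finset.mem_Icc.1 (P.1.subset hB hy)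
      rw [h, key] at hB
      obtain ⟨-, C, hC, rfl⟩ := hB
      exact ⟨hx'.2, hy'.2, C, hC, Finset.mem_of_mem_erase hx, Finset.mem_of_mem_erase hy⟩
    · rintro ⟨hx, hy, C, hC, hxC, hyC⟩
      have hx1 : x ∈ C.erase (k + 1) := Finset.mem_erase.2 ⟨by omega, hxC⟩
      have hy1 : y ∈ C.erase (k + 1) := Finset.mem_erase.2 ⟨by omega, hyC⟩
      refine ⟨C.erase (k + 1), ?_, hx1, hy1⟩
      rw [h, key]
      exact ⟨Finset.ne_empty_of_mem hx1, C, hC, rfl⟩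
  · intro h
    have herase : ∀ x ≤ k, ∀ B ∈ P.1.parts, ∀ C ∈ P'.1.parts, x ∈ B → x ∈ C →
        C.erase (k + 1) = B := by
      intro x hxk B hB C hC hxB hxC
      ext y
      rw [Finset.mem_erase, SameBlock.mem_iff hB hxB, SameBlock.mem_iff hC hxC, h]
      refine ⟨fun ⟨h1, h2⟩ => ⟨hxk, ?_, h2⟩, fun ⟨_, h2, h3⟩ => ⟨by omega, h3⟩⟩
      have := Finset.mem_Icc.1 h2.right_mem
      omega
    rw [IsRestriction]
    ext B
    rw [key]
    constructor
    · intro hB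
      obtain ⟨x, hx⟩ := P.1.nonempty_of_mem_parts hB
      obtain ⟨hxk, -, C, hC, hxC, -⟩ := (h x x).1 ⟨B, hB, hx, hx⟩
      exact ⟨Finset.ne_empty_of_mem hx, C, hC, herase x hxk B hB C hC hx hxC⟩
    · rintro ⟨hne, C, hC, rfl⟩
      obtain ⟨x, hx⟩ := Finset.nonempty_of_ne_empty hne
      obtain ⟨hx1, hxC⟩ := Finset.mem_erase.1 hx
      have hxk : x ≤ k := by
        have := Finset.mem_Icc.1 (P'.1.subset hC hxC)
        omega
      obtain ⟨B, hB, hxB, -⟩ := (h x x).2 ⟨hxk, hxk, C, hC, hxC, hxC⟩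
      rwa [herase x hxk B hB C hC hxB hxC]

theorem existsUnique_isRestriction (P' : NC (k + 1)) : ∃! P : NC k, IsRestriction P P' := by
  obtain ⟨P, hP⟩ := SameBlock.exists_finpartition (Finset.Icc 1 k)
    (fun x y => x ≤ k ∧ y ≤ k ∧ SameBlock P'.1 x y)
    (fun x hx => by
      rw [Finset.mem_Icc] at hx
      exact ⟨hx.2, hx.2, SameBlock.refl _ (Finset.mem_Icc.2 ⟨hx.1, by omega⟩)⟩)
    (fun x y h => ⟨h.2.1, h.1, h.2.2.symm⟩)
    (fun x y z h h' => ⟨h.1, h'.2.1, h.2.2.trans h'.2.2⟩)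
    (fun x y h => Finset.mem_Icc.2 ⟨(Finset.mem_Icc.1 h.2.2.left_mem).1, h.1⟩)
  have hnc : IsNoncrossing P := by
    rw [isNoncrossing_iff]
    intro a b c d hab hbc hcd h1 h2
    rw [hP] at *
    exact ⟨h1.1, h2.1, isNoncrossing_iff.1 P'.2 a b c d hab hbc hcd h1.2.2 h2.2.2⟩
  refine ⟨⟨P, hnc⟩, isRestriction_iff.2 hP, fun Q hQ => NC.ext fun x y => ?_⟩
  rw [isRestriction_iff.1 hQ, ← hP]

/-! ### Extending one noncrossing partition by a new largest element. -/

/-- The places where `k + 1` can be added to `P`: the least elements of the blocks that are not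
nested below another block, and `k + 1` itself, which stands for a new block. -/
noncomputable def outerMins (P : NC k) : Finset ℕ := by
  classical exact (Finset.Icc 1 (k + 1)).filter fun x => ∀ u v, u < x → x ≤ v → ¬ SameBlock P.1 u v

theorem mem_outerMins {P : NC k} {x : ℕ} : x ∈ outerMins P ↔
    (1 ≤ x ∧ x ≤ k + 1) ∧ ∀ u v, u < x → x ≤ v → ¬ SameBlock P.1 u v := by
  classical
  rw [outerMins, Finset.mem_filter, Finset.mem_Icc]

theorem outerMins_eq_of_sameBlock {P : NC k} {x y : ℕ} (hx : x ∈ outerMins P)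
    (hy : y ∈ outerMins P) (h : SameBlock P.1 x y) : x = y := by
  rcases lt_trichotomy x y with hxy | hxy | hxy
  · exact absurd h ((mem_outerMins.1 hy).2 x y hxy le_rfl)
  · exact hxy
  · exact absurd h.symm ((mem_outerMins.1 hx).2 y x hxy le_rfl)

/-- `P'` arises from `P` by adding `k + 1` to the block of `b`, or as a new block if `b = k + 1`. -/
def IsExtension (P : NC k) (b : ℕ) (P' : NC (k + 1)) : Prop :=
  ∀ x y, SameBlock P'.1 x y ↔ SameBlock P.1 x y ∨ (x = k + 1 ∧ y = k + 1) ∨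
    (x = k + 1 ∧ SameBlock P.1 b y) ∨ (y = k + 1 ∧ SameBlock P.1 b x)

theorem SameBlock.le {P : NC k} {x y : ℕ} (h : SameBlock P.1 x y) :
    (1 ≤ x ∧ x ≤ k) ∧ 1 ≤ y ∧ y ≤ k :=
  ⟨Finset.mem_Icc.1 h.left_mem, Finset.mem_Icc.1 h.right_mem⟩

theorem exists_isExtension {P : NC k} {b : ℕ} (hb : b ∈ outerMins P) :
    ∃ P' : NC (k + 1), IsExtension P b P' := by
  obtain ⟨P', hP'⟩ := SameBlock.exists_finpartition (Finset.Icc 1 (k + 1))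
    (fun x y => SameBlock P.1 x y ∨ (x = k + 1 ∧ y = k + 1) ∨
      (x = k + 1 ∧ SameBlock P.1 b y) ∨ (y = k + 1 ∧ SameBlock P.1 b x))
    (fun x hx => by
      rw [Finset.mem_Icc] at hx
      rcases Nat.lt_or_ge k x with h | h
      · exact Or.inr (Or.inl ⟨by omega, by omega⟩)
      · exact Or.inl (SameBlock.refl _ (Finset.mem_Icc.2 ⟨hx.1, h⟩)))
    (by
      rintro x y (h | h | h | h)
      · exact Or.inl h.symm
      · exact Or.inr (Or.inl h.symm)
      · exact Or.inr (Or.inr (Or.inr h))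
      · exact Or.inr (Or.inr (Or.inl h)))
    (by
      rintro x y z (h | ⟨rfl, rfl⟩ | ⟨rfl, h⟩ | ⟨rfl, h⟩) (h' | ⟨h1, rfl⟩ | ⟨h1, h'⟩ | ⟨rfl, h'⟩)
      · exact Or.inl (h.trans h')
      · have := h.le; omega
      · have := h.le; omega
      · exact Or.inr (Or.inr (Or.inr ⟨rfl, h'.trans h.symm⟩))
      · have := h'.le; omega
      · exact Or.inr (Or.inl ⟨rfl, rfl⟩)
      · exact Or.inr (Or.inr (Or.inl ⟨rfl, h'⟩))
      · exact Or.inr (Or.inl ⟨rfl, rfl⟩)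
      · exact Or.inr (Or.inr (Or.inl ⟨rfl, h.trans h'⟩))
      · exact Or.inr (Or.inl ⟨rfl, rfl⟩)
      · have := h.le; omega
      · exact Or.inr (Or.inl ⟨rfl, rfl⟩)
      · have := h'.le; omega
      · exact Or.inr (Or.inr (Or.inr ⟨rfl, h⟩))
      · exact Or.inl (h.symm.trans h')
      · exact Or.inr (Or.inr (Or.inr ⟨rfl, h⟩)))
    (by
      rintro x y (h | h | h | h) <;> rw [Finset.mem_Icc]
      · have := h.le; omega
      · omega
      · omega
      · have := h.2.le; omega)
  refine ⟨⟨P', ?_⟩, hP'⟩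
  rw [isNoncrossing_iff]
  intro x y z w hxy hyz hzw h1 h2
  have hw := Finset.mem_Icc.1 h2.right_mem
  rw [hP'] at *
  rcases h1 with h1 | h1 | h1 | h1
  · rcases h2 with h2 | h2 | h2 | h2
    · exact Or.inl (isNoncrossing_iff.1 P.2 x y z w hxy hyz hzw h1 h2)
    · omega
    · omega
    -- The only possible new crossing: `w = k + 1`, and `x`, `z` of one block enclose an element `y`
    -- of the block of `b`. If `b < x`, noncrossingness of `P` already merges the blocks; if `x <
    -- b`, then either `x, z` or `y, b` violates that `b` is an outer minimum.
    · rcases lt_trichotomy b x with hb' | rfl | hb'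
      · exact Or.inl ((isNoncrossing_iff.1 P.2 b x y z hb' hxy hyz h2.2 h1).symm.trans h2.2)
      · exact Or.inl h2.2
      · by_cases hbz : b ≤ z
        · exact absurd h1 ((mem_outerMins.1 hb).2 x z hb' hbz)
        · exact absurd h2.2.symm ((mem_outerMins.1 hb).2 y b (by omega) le_rfl)
  · omega
  · omega
  · omega

theorem IsExtension.isRestriction {P : NC k} {b : ℕ} {P' : NC (k + 1)} (h : IsExtension P b P') :
    IsRestriction P P' := by
  rw [isRestriction_iff]
  intro x y
  rw [h x y]
  constructor
  · intro h1
    have := h1.le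
    exact ⟨by omega, by omega, Or.inl h1⟩
  · rintro ⟨hx, hy, h1 | h1 | h1 | h1⟩
    · exact h1
    · omega
    · omega
    · omega

theorem IsRestriction.exists_isExtension {P : NC k} {P' : NC (k + 1)} (h : IsRestriction P P') :
    ∃ b ∈ outerMins P, IsExtension P b P' := by
  classical
  rw [isRestriction_iff] at h
  have hk : SameBlock P'.1 (k + 1) (k + 1) := SameBlock.refl _ (by simp)
  -- The site is the least element of the block of `k + 1`; it is `k + 1` itself if that block is a
  -- singleton.
  have hex : ∃ x, SameBlock P'.1 x (k + 1) := ⟨_, hk⟩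
  have hb := Nat.find_spec hex
  have hmin : ∀ x, SameBlock P'.1 x (k + 1) → Nat.find hex ≤ x := fun x hx => Nat.find_min' hex hx
  generalize Nat.find hex = b at hb hmin
  have hbk := hb.le
  refine ⟨b, mem_outerMins.2 ⟨hbk.1, ?_⟩, ?_⟩
  · intro u v hu hv huv
    obtain ⟨h1, h2, h3⟩ := (h u v).1 huv
    rcases hv.lt_or_eq with hv | rfl
    · have := isNoncrossing_iff.1 P'.2 u b v (k + 1) hu hv (by omega) h3 hb
      have := hmin u (this.trans hb)
      omega
    · have := hmin u (h3.trans hb)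
      omega
  · intro x y
    rw [h x y, h b x, h b y]
    constructor
    · intro hxy
      have hle := hxy.le
      by_cases hx : x = k + 1
      · by_cases hy : y = k + 1
        · exact Or.inr (Or.inl ⟨hx, hy⟩)
        · subst hx
          have := hmin y hxy.symm
          exact Or.inr (Or.inr (Or.inl ⟨rfl, by omega, by omega, hb.trans hxy⟩))
      · by_cases hy : y = k + 1
        · subst hy
          have := hmin x hxy
          exact Or.inr (Or.inr (Or.inr ⟨rfl, by omega, by omega, hb.trans hxy.symm⟩))
        · exact Or.inl ⟨by omega, by omega, hxy⟩
    · rintro (h1 | ⟨rfl, rfl⟩ | ⟨rfl, h1⟩ | ⟨rfl, h1⟩)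
      · exact h1.2.2
      · exact hk
      · exact hb.symm.trans h1.2.2
      · exact h1.2.2.symm.trans hb

namespace IsExtension

variable {P Q : NC k} {b a : ℕ} {P' Q' : NC (k + 1)}

theorem left_unique {c : ℕ} (hb : b ∈ outerMins P) (hc : c ∈ outerMins P)
    (h : IsExtension P b P') (h' : IsExtension P c P') : b = c := by
  have aux : ∀ b c, b ∈ outerMins P → c ∈ outerMins P → IsExtension P b P' →
      IsExtension P c P' → b ≤ k → b = c := by
    intro b c hb hc h h' hbk
    have h1 : SameBlock P'.1 (k + 1) b := (h _ _).2 (Or.inr (Or.inr (Or.inl ⟨rfl,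
      SameBlock.refl _ (Finset.mem_Icc.2 ⟨(mem_outerMins.1 hb).1.1, hbk⟩)⟩)))
    rcases (h' _ _).1 h1 with h2 | h2 | h2 | h2
    · have := h2.le; omega
    · omega
    · exact (outerMins_eq_of_sameBlock hc hb h2.2).symm
    · omega
  have h1 := (mem_outerMins.1 hb).1
  have h2 := (mem_outerMins.1 hc).1
  by_cases hbk : b ≤ k
  · exact aux b c hb hc h h' hbk
  by_cases hck : c ≤ k
  · exact (aux c b hc hb h' h hck).symm
  omega

/-- The new pair `b`, `k + 1` covers every candidate after `b` up to `k + 1` and leaves those up to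
`b` untouched. For `b = k + 1` nothing is covered, and `k + 1` becomes an actual minimum. -/
theorem mem_outerMins_iff (hb : b ∈ outerMins P) (h : IsExtension P b P') {x : ℕ} :
    x ∈ outerMins P' ↔ x = k + 2 ∨ (x ∈ outerMins P ∧ x ≤ b) := by
  have hb' := mem_outerMins.1 hb
  rw [mem_outerMins, mem_outerMins]
  constructor
  · rintro ⟨h1, h2⟩
    by_cases hx : x = k + 2
    · exact Or.inl hx
    refine Or.inr ⟨⟨⟨h1.1, by omega⟩, fun u v hu hv huv => h2 u v hu hv ((h _ _).2 (Or.inl huv))⟩, ?_⟩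
    by_contra hbx
    exact h2 b (k + 1) (by omega) (by omega) ((h _ _).2 (Or.inr (Or.inr (Or.inr ⟨rfl,
      SameBlock.refl _ (Finset.mem_Icc.2 ⟨hb'.1.1, by omega⟩)⟩))))
  · rintro (rfl | ⟨⟨h1, h2⟩, h3⟩)
    · refine ⟨by omega, fun u v hu hv huv => ?_⟩
      have := huv.le
      omega
    · refine ⟨by omega, fun u v hu hv huv => ?_⟩
      rcases (h _ _).1 huv with h4 | h4 | h4 | h4
      · exact h2 u v hu hv h4
      · omega
      · omega
      · exact hb'.2 u b (by omega) le_rfl h4.2.symm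

theorem le_iff (hPQ : P ≤ Q) (ha : a ∈ outerMins P)
    (h : IsExtension P a P') (h' : IsExtension Q b Q') :
    P' ≤ Q' ↔ a = k + 1 ∨ SameBlock Q.1 b a := by
  have ha' := (mem_outerMins.1 ha).1
  have hPQ' := SameBlock.le_iff.1 hPQ
  have hle : P' ≤ Q' ↔ ∀ x y, SameBlock P'.1 x y → SameBlock Q'.1 x y := SameBlock.le_iff
  rw [hle]
  constructor
  · intro hr
    by_cases hak : a = k + 1
    · exact Or.inl hak
    refine Or.inr ?_
    have h1 := hr (k + 1) a ((h _ _).2 (Or.inr (Or.inr (Or.inl ⟨rfl,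
      SameBlock.refl _ (Finset.mem_Icc.2 ⟨ha'.1, by omega⟩)⟩))))
    rcases (h' _ _).1 h1 with h2 | h2 | h2 | h2
    · have := h2.le; omega
    · omega
    · exact h2.2
    · omega
  · intro hab x y hxy
    rw [h' x y]
    have key : ∀ z, SameBlock P.1 a z → SameBlock Q.1 b z := by
      intro z hz
      rcases hab with hab | hab
      · have := hz.le; omega
      · exact hab.trans (hPQ' _ _ hz)
    rcases (h _ _).1 hxy with h1 | h1 | h1 | h1
    · exact Or.inl (hPQ' _ _ h1)
    · exact Or.inr (Or.inl h1)
    · exact Or.inr (Or.inr (Or.inl ⟨h1.1, key _ h1.2⟩))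
    · exact Or.inr (Or.inr (Or.inr ⟨h1.1, key _ h1.2⟩))

end IsExtension

/-! ### Extending an interval: pairs of sites in lexicographic order. -/

/-- The places `(b, a)` where `k + 1` can be added to the two partitions of an interval. -/
noncomputable def intervalSites (I : IntNC k) : Finset (ℕ ×ₗ ℕ) := by
  classical exact ((outerMins I.snd ×ˢ outerMins I.fst).filter
    fun s => s.2 = k + 1 ∨ SameBlock I.snd.1 s.1 s.2).map toLex.toEmbedding

theorem mem_intervalSites {I : IntNC k} {b a : ℕ} : toLex (b, a) ∈ intervalSites I ↔
    b ∈ outerMins I.snd ∧ a ∈ outerMins I.fst ∧ (a = k + 1 ∨ SameBlock I.snd.1 b a) := by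
  classical
  simp [intervalSites, and_assoc]

/-- The extension keeps the first coordinates up to `b` and the second ones up to `a`. For a first
coordinate smaller than `b` the second bound is automatic, which is why the order is lexicographic
with the coarser partition first. The symbol for a new block changes from `k + 1` to `k + 2`. -/
theorem mem_intervalSites_iff_of_isExtension {I : IntNC k} {J : IntNC (k + 1)} {b a : ℕ}
    (hs : toLex (b, a) ∈ intervalSites I) (hb : IsExtension I.snd b J.snd)
    (ha : IsExtension I.fst a J.fst) (x y : ℕ) :
    toLex (x, y) ∈ intervalSites J ↔
      (toLex (x, y) ∈ intervalSites I ∧ toLex (x, y) < toLex (b, a) ∧ y ≤ k) ∨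
      (toLex (x, k + 1) ∈ intervalSites I ∧ toLex (x, k + 1) < toLex (b, a) ∧ y = k + 2) ∨
      (x = b ∧ y = a) ∨ (x = b ∧ y = k + 2) ∨ (x = k + 2 ∧ y = k + 2) := by
  simp only [mem_intervalSites, Prod.Lex.toLex_lt_toLex] at hs ⊢
  obtain ⟨hbm, ham, hba⟩ := hs
  rw [hb.mem_outerMins_iff hbm, ha.mem_outerMins_iff ham]
  have hb1 := (mem_outerMins.1 hbm).1
  have ha1 := (mem_outerMins.1 ham).1
  have hk1 : k + 1 ∈ outerMins I.fst := by
    rw [mem_outerMins]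
    refine ⟨by omega, fun u v hu hv huv => ?_⟩
    have := huv.le
    omega
  have hself : ∀ z, z ∈ outerMins I.snd → z ≤ k → SameBlock I.snd.1 z z := fun z hz hzk =>
    SameBlock.refl _ (Finset.mem_Icc.2 ⟨(mem_outerMins.1 hz).1.1, hzk⟩)
  constructor
  · rintro ⟨hx, hy, hxy⟩
    rcases hx with rfl | ⟨hx, hxb⟩
    · rcases hxy with rfl | hxy
      · simp
      · have := hxy.le; omega
    have hx1 := (mem_outerMins.1 hx).1
    rcases hy with rfl | ⟨hy, hya⟩
    · rcases hxb.lt_or_eq with h | rfl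
      · exact Or.inr (Or.inl ⟨⟨hx, hk1, Or.inl trivial⟩, Or.inl h, rfl⟩)
      · simp
    have hy1 := (mem_outerMins.1 hy).1
    rcases hxy with hxy | hxy
    · omega
    rcases (hb _ _).1 hxy with h | h | h | h
    · have := h.le
      by_cases heq : x = b ∧ y = a
      · exact Or.inr (Or.inr (Or.inl heq))
      · exact Or.inl ⟨⟨hx, hy, Or.inr h⟩, by omega, by omega⟩
    · exact Or.inr (Or.inr (Or.inl (by omega)))
    · have := h.2.le; omega
    · have := outerMins_eq_of_sameBlock hbm hx h.2
      exact Or.inr (Or.inr (Or.inl (by omega)))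
  · rintro (⟨⟨hx, hy, hxy⟩, hlt, hyk⟩ | ⟨⟨hx, -, -⟩, hlt, rfl⟩ | ⟨rfl, rfl⟩ | ⟨rfl, rfl⟩ | ⟨rfl, rfl⟩)
    · have hxy' : SameBlock I.snd.1 x y := hxy.resolve_left (by omega)
      refine ⟨Or.inr ⟨hx, by omega⟩, Or.inr ⟨hy, ?_⟩, Or.inr ((hb _ _).2 (Or.inl hxy'))⟩
      -- If `a < y` and `x < b`, then `x < b ≤ a < y` with `x`, `y` in one block of the coarser
      -- partition, so `b` would not be an outer minimum.
      by_contra hya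
      rcases hlt with hlt | hlt
      · have h1 : SameBlock I.snd.1 b a := hba.resolve_left (by omega)
        have h2 : b ≤ a := by
          by_contra hlt'
          exact (mem_outerMins.1 hbm).2 a b (by omega) le_rfl h1.symm
        exact (mem_outerMins.1 hbm).2 x y hlt (by omega) hxy'
      · omega
    · exact ⟨Or.inr ⟨hx, by omega⟩, Or.inl rfl, Or.inl rfl⟩
    · refine ⟨Or.inr ⟨hbm, le_rfl⟩, Or.inr ⟨ham, le_rfl⟩, Or.inr ?_⟩
      rw [hb]
      rcases hba with rfl | hba
      · by_cases hxk : x = k + 1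
        · exact Or.inr (Or.inl ⟨hxk, rfl⟩)
        · exact Or.inr (Or.inr (Or.inr ⟨rfl, hself x hbm (by omega)⟩))
      · exact Or.inl hba
    · exact ⟨Or.inr ⟨hbm, le_rfl⟩, Or.inl rfl, Or.inl rfl⟩
    · exact ⟨Or.inl rfl, Or.inl rfl, Or.inl rfl⟩

theorem card_intervalSites_of_isExtension {I : IntNC k} {J : IntNC (k + 1)} {b a : ℕ}
    (hs : toLex (b, a) ∈ intervalSites I) (hb : IsExtension I.snd b J.snd)
    (ha : IsExtension I.fst a J.fst) :
    (intervalSites J).card = 3 + ((intervalSites I).filter (· < toLex (b, a))).card := by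
  classical
  have hba := mem_intervalSites.1 hs
  have hb1 := (mem_outerMins.1 hba.1).1
  have ha1 := (mem_outerMins.1 hba.2.1).1
  have hle : ∀ x y, toLex (x, y) ∈ intervalSites I → y ≤ k + 1 := fun x y h =>
    (mem_outerMins.1 (mem_intervalSites.1 h).2.1).1.2
  -- `ψ` renames the new-block symbol; it is injective on the second coordinates of old sites
  -- because these are at most `k + 1`.
  obtain ⟨ψ, hψ, hψ'⟩ : ∃ ψ : ℕ → ℕ, ψ (k + 1) = k + 2 ∧ ∀ y ≤ k, ψ y = y :=
    ⟨fun y => if y = k + 1 then k + 2 else y, by simp, fun y hy => if_neg (by omega)⟩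
  let φ : ℕ ×ₗ ℕ → ℕ ×ₗ ℕ := fun s => toLex ((ofLex s).1, ψ (ofLex s).2)
  have hψ'' : ∀ y ≤ k + 1, (y = k + 1 ∧ ψ y = k + 2) ∨ (y ≤ k ∧ ψ y = y) := by
    intro y hy
    rcases hy.eq_or_lt with rfl | hy
    · exact Or.inl ⟨rfl, hψ⟩
    · exact Or.inr ⟨by omega, hψ' y (by omega)⟩
  have hset : intervalSites J = ((intervalSites I).filter (· < toLex (b, a))).image φ ∪
      {toLex (b, a), toLex (b, k + 2), toLex (k + 2, k + 2)} := by
    ext s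
    obtain ⟨⟨x, y⟩, rfl⟩ := toLex.surjective s
    rw [mem_intervalSites_iff_of_isExtension hs hb ha]
    simp only [Finset.mem_union, Finset.mem_image, Finset.mem_filter, Finset.mem_insert,
      Finset.mem_singleton, EmbeddingLike.apply_eq_iff_eq, Prod.mk.injEq]
    rw [← or_assoc]
    refine or_congr_left ⟨?_, ?_⟩
    · rintro (⟨h1, h2, h3⟩ | ⟨h1, h2, rfl⟩)
      · exact ⟨_, ⟨h1, h2⟩, by simp only [φ, ofLex_toLex, hψ' y h3]⟩
      · exact ⟨_, ⟨h1, h2⟩, by simp only [φ, ofLex_toLex, hψ]⟩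
    · rintro ⟨t, ⟨h1, h2⟩, h3⟩
      obtain ⟨⟨u, v⟩, rfl⟩ := toLex.surjective t
      have hv := hle _ _ h1
      simp only [φ, ofLex_toLex, EmbeddingLike.apply_eq_iff_eq, Prod.mk.injEq] at h3
      obtain ⟨rfl, h3⟩ := h3
      rcases hψ'' v hv with ⟨rfl, h4⟩ | ⟨h5, h4⟩
      · exact Or.inr ⟨h1, h2, h3.symm.trans h4⟩
      · obtain rfl := h4.symm.trans h3
        exact Or.inl ⟨h1, h2, h5⟩
  rw [hset, Finset.card_union_of_disjoint, Finset.card_image_of_injOn, add_comm]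
  · congr 1
    rw [Finset.card_insert_of_notMem, Finset.card_insert_of_notMem, Finset.card_singleton]
    · simp only [Finset.mem_singleton, EmbeddingLike.apply_eq_iff_eq, Prod.mk.injEq]
      omega
    · simp only [Finset.mem_insert, Finset.mem_singleton, EmbeddingLike.apply_eq_iff_eq,
        Prod.mk.injEq]
      omega
  · intro s hs' t ht hst
    obtain ⟨⟨x, y⟩, rfl⟩ := toLex.surjective s
    obtain ⟨⟨u, v⟩, rfl⟩ := toLex.surjective t
    have h1 := hle _ _ (Finset.mem_filter.1 (Finset.mem_coe.1 hs')).1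
    have h2 := hle _ _ (Finset.mem_filter.1 (Finset.mem_coe.1 ht)).1
    simp only [φ, ofLex_toLex, EmbeddingLike.apply_eq_iff_eq, Prod.mk.injEq] at hst ⊢
    refine ⟨hst.1, ?_⟩
    have := hψ'' y h1
    have := hψ'' v h2
    omega
  · rw [Finset.disjoint_left]
    intro s hs' hs''
    obtain ⟨t, ht, rfl⟩ := Finset.mem_image.1 hs'
    obtain ⟨⟨u, v⟩, rfl⟩ := toLex.surjective t
    obtain ⟨ht1, ht2⟩ := Finset.mem_filter.1 ht
    have h1 := hle _ _ ht1
    have h3 := (mem_outerMins.1 (mem_intervalSites.1 ht1).1).1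
    rw [Prod.Lex.toLex_lt_toLex] at ht2
    simp only [φ, ofLex_toLex, Finset.mem_insert, Finset.mem_singleton,
      EmbeddingLike.apply_eq_iff_eq, Prod.mk.injEq] at hs'' ht2
    have := hψ'' v h1
    omega

theorem existsUnique_intervalGenerates (J : IntNC (k + 1)) :
    ∃! I : IntNC k, intervalGenerates k I J := by
  obtain ⟨P, hP, hPu⟩ := existsUnique_isRestriction J.fst
  obtain ⟨Q, hQ, hQu⟩ := existsUnique_isRestriction J.snd
  have hle : P ≤ Q := by
    refine SameBlock.le_iff.2 fun x y hxy => ?_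
    rw [isRestriction_iff.1 hP] at hxy
    rw [isRestriction_iff.1 hQ]
    exact ⟨hxy.1, hxy.2.1, SameBlock.le_iff.1 J.fst_le_snd _ _ hxy.2.2⟩
  refine ⟨⟨⟨P, Q⟩, hle⟩, ⟨hP, hQ⟩, fun I hI => ?_⟩
  exact NonemptyInterval.ext (Prod.ext (hPu _ hI.1) (hQu _ hI.2))

theorem exists_intervalChild (I : IntNC k) (s : intervalSites I) :
    ∃ J : IntNC (k + 1), IsExtension I.snd (ofLex s.1).1 J.snd ∧
      IsExtension I.fst (ofLex s.1).2 J.fst := by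
  obtain ⟨h1, h2, h3⟩ := mem_intervalSites.1 s.2
  obtain ⟨Q, hQ⟩ := exists_isExtension h1
  obtain ⟨P, hP⟩ := exists_isExtension h2
  exact ⟨⟨⟨P, Q⟩, (IsExtension.le_iff I.fst_le_snd h2 hP hQ).2 h3⟩, hQ, hP⟩

theorem intNC_zero_eq (I : IntNC 0) (P : NC 0) : I.fst = P ∧ I.snd = P := by
  have : ∀ Q : NC 0, Q = P := fun Q => NC.ext fun x y =>
    ⟨fun h => by have := h.le; omega, fun h => by have := h.le; omega⟩
  exact ⟨this _, this _⟩

theorem isLabelTree_intNC : IsLabelTree IntNC intervalGenerates := by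
  refine IsLabelTree.of_sites (fun _ I => intervalSites I) ?_
    (fun n y => existsUnique_intervalGenerates y) ?_
  · obtain ⟨P, hP⟩ := SameBlock.exists_finpartition (Finset.Icc 1 0) (fun _ _ => False)
      (by simp) (by simp) (by simp) (by simp)
    have hnc : IsNoncrossing P := isNoncrossing_iff.2 (by simp [hP])
    refine ⟨⟨⟨⟨P, hnc⟩, ⟨P, hnc⟩⟩, le_rfl⟩, fun I => ?_, ?_⟩
    · obtain ⟨h1, h2⟩ := intNC_zero_eq I ⟨P, hnc⟩
      exact NonemptyInterval.ext (Prod.ext h1 h2)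
    · rw [Finset.card_eq_one]
      -- For `k = 0` the only site forms a new block, named `k + 1 = 1`, in both partitions.
      refine ⟨toLex (1, 1), ?_⟩
      ext s
      obtain ⟨⟨x, y⟩, rfl⟩ := toLex.surjective s
      simp only [mem_intervalSites, mem_outerMins, hP, Finset.mem_singleton,
        EmbeddingLike.apply_eq_iff_eq, Prod.mk.injEq]
      constructor
      · rintro ⟨h1, h2, -⟩
        omega
      · rintro ⟨rfl, rfl⟩
        simp
  · intro n I
    choose c hc using exists_intervalChild I
    refine ⟨c, ?_, ?_, ?_⟩
    · rintro ⟨s, hs⟩ ⟨t, ht⟩ hst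
      have h1 := hc ⟨s, hs⟩
      have h2 := hc ⟨t, ht⟩
      rw [hst] at h1
      obtain ⟨hs1, hs2, -⟩ := mem_intervalSites.1 hs
      obtain ⟨ht1, ht2, -⟩ := mem_intervalSites.1 ht
      exact Subtype.ext (Prod.ext (h1.1.left_unique hs1 ht1 h2.1) (h1.2.left_unique hs2 ht2 h2.2))
    · intro J
      constructor
      · rintro ⟨h1, h2⟩
        obtain ⟨a, ha, hPa⟩ := h1.exists_isExtension
        obtain ⟨b, hb, hQb⟩ := h2.exists_isExtension
        have hs : toLex (b, a) ∈ intervalSites I := mem_intervalSites.2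
          ⟨hb, ha, (IsExtension.le_iff I.fst_le_snd ha hPa hQb).1 J.fst_le_snd⟩
        refine ⟨⟨_, hs⟩, ?_⟩
        have h3 := hc ⟨_, hs⟩
        exact NonemptyInterval.ext (Prod.ext
          (NC.ext fun x y => (h3.2 x y).trans (hPa x y).symm)
          (NC.ext fun x y => (h3.1 x y).trans (hQb x y).symm))
      · rintro ⟨s, rfl⟩
        exact ⟨(hc s).2.isRestriction, (hc s).1.isRestriction⟩
    · rintro ⟨s, hs⟩
      obtain ⟨⟨b, a⟩, rfl⟩ := toLex.surjective s
      have := hc ⟨_, hs⟩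
      exact card_intervalSites_of_isExtension hs this.1 this.2

/-! ### Descents and words that decompose into tight hooks -/

/-- The number of descents of a word. -/
def desCount : List ℕ → ℕ
  | [] => 0
  | [_] => 0
  | x :: y :: l => (if y < x then 1 else 0) + desCount (y :: l)

theorem desCount_append_cons_cons (α : List ℕ) (a b : ℕ) (β : List ℕ) :
    desCount (α ++ a :: b :: β) =
      desCount (α ++ [a]) + (if b < a then 1 else 0) + desCount (b :: β) := by
  induction α with
  | nil => simp [desCount]
  | cons x α ih =>
    cases α with
    | nil => simp [desCount, add_assoc]
    | cons y α =>
      simp only [List.cons_append, desCount] at ih ⊢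
      omega

theorem desCount_append_max {v : List ℕ} {m : ℕ} (h : ∀ x ∈ v, x < m) :
    desCount (v ++ [m]) = desCount v := by
  rcases List.eq_nil_or_concat' v with rfl | ⟨u, a, rfl⟩
  · simp [desCount]
  · have ha := h a (by simp)
    rw [List.append_assoc, List.singleton_append, desCount_append_cons_cons, if_neg (by omega)]
    simp [desCount]

theorem desCount_append_le (u v : List ℕ) : desCount (u ++ v) ≤ desCount u + 1 + desCount v := by
  rcases List.eq_nil_or_concat' u with rfl | ⟨u, a, rfl⟩
  · simp
  cases v with
  | nil => rw [List.append_nil]; omega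
  | cons b v =>
    rw [List.append_assoc, List.singleton_append, desCount_append_cons_cons]
    split_ifs <;> omega

theorem desCount_map {f : ℕ → ℕ} {w : List ℕ} (hf : ∀ x ∈ w, ∀ y ∈ w, (f x < f y ↔ x < y)) :
    desCount (w.map f) = desCount w := by
  induction w with
  | nil => rfl
  | cons x w ih =>
    cases w with
    | nil => rfl
    | cons y w =>
      have ih := ih fun a ha b hb => hf a (List.mem_cons_of_mem _ ha) b (List.mem_cons_of_mem _ hb)
      have := hf y (by simp) x (by simp)
      simp only [List.map_cons, desCount] at ih ⊢
      rw [ih]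
      simp only [this]

/-- Words built from single letters by `(α a), (b β) ↦ (α a) (b β) m` with `b < a` and `m` a new
largest letter. The permutations among them are the uniquely sorted ones. -/
inductive TightSorted : List ℕ → Prop
  | single (x : ℕ) : TightSorted [x]
  | join {α : List ℕ} {a b : ℕ} {β : List ℕ} {m : ℕ} : TightSorted (α ++ [a]) →
      TightSorted (b :: β) → b < a → (∀ x ∈ α ++ a :: b :: β, x < m) →
      TightSorted (α ++ a :: b :: β ++ [m])

theorem append_cons_cons_eq (α : List ℕ) (a b : ℕ) (β : List ℕ) :
    α ++ a :: b :: β = (α ++ [a]) ++ (b :: β) := by simp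

/-- A nonempty prefix `u` is balanced if its length is the one that its number of descents allows at
least. -/
def Balanced (u : List ℕ) : Prop := u.length = 2 * desCount u + 1

theorem prefix_join {α : List ℕ} {a b : ℕ} {β : List ℕ} {m : ℕ} {u : List ℕ}
    (h : u <+: α ++ a :: b :: β ++ [m]) :
    u = α ++ a :: b :: β ++ [m] ∨ u <+: α ++ [a] ∨
      ∃ v, b :: v <+: b :: β ∧ u = α ++ a :: b :: v := by
  rcases List.prefix_concat_iff.1 h with h | h
  · exact Or.inl h
  refine Or.inr ?_
  rw [append_cons_cons_eq] at h
  rcases Nat.lt_or_ge (α ++ [a]).length u.length with hl | hl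
  · right
    obtain ⟨v, rfl⟩ := List.prefix_of_prefix_length_le (List.prefix_append (α ++ [a]) (b :: β)) h
      hl.le
    rw [List.prefix_append_right_inj] at h
    cases v with
    | nil => simp at hl
    | cons c v =>
      obtain rfl := (List.cons_prefix_cons.1 h).1
      exact ⟨v, h, by simp⟩
  · exact Or.inl (List.prefix_of_prefix_length_le h (List.prefix_append _ _) hl)

namespace TightSorted

/-- The junction is a descent and the step to `m` is not: `(2d₁ + 1) + (2d₂ + 1) + 1 = 2(d₁ + 1 +
d₂) + 1`. -/
theorem balanced {w : List ℕ} (h : TightSorted w) : Balanced w := by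
  unfold Balanced
  induction h with
  | single x => rfl
  | join h1 h2 hba hm ih1 ih2 =>
    rw [desCount_append_max hm, desCount_append_cons_cons, if_pos hba]
    simp only [List.length_append, List.length_cons, List.length_nil] at *
    omega

theorem exists_last {w : List ℕ} (h : TightSorted w) : ∃ v m, w = v ++ [m] ∧ ∀ x ∈ v, x < m := by
  cases h with
  | single x => exact ⟨[], x, rfl, by simp⟩
  | join h1 h2 hba hm => exact ⟨_, _, rfl, hm⟩

theorem lt_last {v : List ℕ} {m : ℕ} (h : TightSorted (v ++ [m])) : ∀ x ∈ v, x < m := by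
  obtain ⟨v', m', h1, h2⟩ := h.exists_last
  obtain ⟨rfl, h3⟩ := List.append_inj' h1 rfl
  obtain rfl : m = m' := by simpa using h3
  exact h2

/-- A prefix reaching past `a` gains the descent `a b`, worth two letters in the bound, while the
bounds for its two pieces add up to only one letter more than a single bound. -/
theorem length_prefix_le {w : List ℕ} (h : TightSorted w) {u : List ℕ} (hu : u <+: w)
    (hne : u ≠ []) : u.length ≤ 2 * desCount u + 1 := by
  induction h generalizing u with
  | single x =>
    have := hu.length_le
    simp only [List.length_singleton] at this
    omega
  | @join α a b β m h1 h2 hba hm ih1 ih2 =>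
    rcases prefix_join hu with rfl | hu | ⟨v, hv, rfl⟩
    · exact (join h1 h2 hba hm).balanced.le
    · exact ih1 hu hne
    · have h3 := ih2 hv (by simp)
      have h4 := h1.balanced
      rw [Balanced] at h4
      rw [desCount_append_cons_cons, if_pos hba]
      simp only [List.length_append, List.length_cons, List.length_nil] at *
      omega

/-- A proper prefix reaching past `a` has length at most `(2d₁ + 1) + (2d₂ + 1) = 2(d₁ + 1 + d₂)`,
one letter short of balanced. Thus `α a` is the longest proper balanced prefix. -/
theorem prefix_of_balanced {α : List ℕ} {a b : ℕ} {β : List ℕ} {m : ℕ} {u : List ℕ}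
    (h1 : TightSorted (α ++ [a])) (h2 : TightSorted (b :: β)) (hba : b < a)
    (hu : u <+: α ++ a :: b :: β ++ [m]) (hb : Balanced u) :
    u = α ++ a :: b :: β ++ [m] ∨ u <+: α ++ [a] := by
  rcases prefix_join hu with hu | hu | ⟨v, hv, rfl⟩
  · exact Or.inl hu
  · exact Or.inr hu
  · have h3 := h2.length_prefix_le hv (by simp)
    have h4 := h1.balanced
    rw [Balanced] at h4 hb
    rw [desCount_append_cons_cons, if_pos hba] at hb
    simp only [List.length_append, List.length_cons, List.length_nil] at *
    omega

theorem of_balanced_prefix {w : List ℕ} (h : TightSorted w) {u : List ℕ} (hu : u <+: w)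
    (hb : Balanced u) : TightSorted u := by
  induction h with
  | single x =>
    rcases List.prefix_concat_iff (l₂ := []) |>.1 hu with rfl | hu
    · exact single x
    · obtain rfl := List.prefix_nil.1 hu
      simp [Balanced] at hb
  | @join α a b β m h1 h2 hba hm ih1 ih2 =>
    rcases prefix_of_balanced h1 h2 hba hu hb with rfl | hu
    · exact join h1 h2 hba hm
    · exact ih1 hu

/-- Each of the two left factors is a balanced prefix and hence lies inside the other. -/
theorem split_unique {α α' : List ℕ} {a a' b b' : ℕ} {β β' : List ℕ}
    (h1 : TightSorted (α ++ [a])) (h2 : TightSorted (b :: β)) (hba : b < a)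
    (h1' : TightSorted (α' ++ [a'])) (h2' : TightSorted (b' :: β')) (hba' : b' < a')
    (h : α ++ a :: b :: β = α' ++ a' :: b' :: β') : α = α' ∧ a = a' ∧ b = b' ∧ β = β' := by
  have aux : ∀ {α α' : List ℕ} {a a' b b' : ℕ} {β β' : List ℕ},
      TightSorted (α ++ [a]) → TightSorted (α' ++ [a']) → TightSorted (b' :: β') → b' < a' →
      α ++ a :: b :: β = α' ++ a' :: b' :: β' → α.length ≤ α'.length := by
    intro α α' a a' b b' β β' h1 h1' h2' hba' h
    have hp : α ++ [a] <+: α' ++ a' :: b' :: β' ++ [0] := by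
      rw [← h]
      exact ⟨b :: β ++ [0], by simp⟩
    rcases prefix_of_balanced h1' h2' hba' hp h1.balanced with h3 | h3
    · rw [← h] at h3
      have := congrArg List.length h3
      simp at this
    · simpa using h3.length_le
  obtain ⟨rfl, h3⟩ := List.append_inj h (le_antisymm (aux h1 h1' h2' hba' h) (aux h1' h1 h2 hba h.symm))
  simpa using h3

theorem map {w : List ℕ} (h : TightSorted w) {f : ℕ → ℕ}
    (hf : ∀ x ∈ w, ∀ y ∈ w, (f x < f y ↔ x < y)) : TightSorted (w.map f) := by
  induction h with
  | single x => exact single _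
  | @join α a b β m h1 h2 hba hm ih1 ih2 =>
    have e1 := ih1 fun x hx y hy => hf x (by aesop) y (by aesop)
    have e2 := ih2 fun x hx y hy => hf x (by aesop) y (by aesop)
    have := join (m := f m) (by simpa using e1) (by simpa using e2)
      ((hf b (by simp) a (by simp)).2 hba) (by
        intro y hy
        rw [← List.map_cons, ← List.map_cons, ← List.map_append] at hy
        obtain ⟨x, hx, rfl⟩ := List.mem_map.1 hy
        exact (hf x (List.mem_append_left _ hx) m (by simp)).2 (hm x hx))
    simpa using this

end TightSorted

/-! ### The stack-sorting map -/

theorem IsPermWord.sublist {u w : List ℕ} (h : IsPermWord w) (hu : u.Sublist w) : IsPermWord u :=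
  ⟨h.1.sublist hu, fun x hx => h.2 x (hu.subset hx)⟩

theorem IsPermWord.perm {u w : List ℕ} (h : IsPermWord w) (hu : u.Perm w) : IsPermWord u :=
  ⟨hu.nodup_iff.2 h.1, fun x hx => h.2 x (hu.mem_iff.1 hx)⟩

theorem stackSort_nil : stackSort [] = [] := by
  rw [stackSort]
  rfl

theorem stackSort_append_cons {L : List ℕ} {n : ℕ} {R : List ℕ} (hL : ∀ x ∈ L, x < n)
    (hR : ∀ x ∈ R, x < n) : stackSort (L ++ n :: R) = stackSort L ++ stackSort R ++ [n] := by
  have hmax : (L ++ n :: R).max? = some n := by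
    rw [List.max?_eq_some_iff]
    refine ⟨by simp, fun b hb => ?_⟩
    rcases List.mem_append.1 hb with hb | hb
    · exact (hL b hb).le
    · rcases List.mem_cons.1 hb with rfl | hb
      · exact le_rfl
      · exact (hR b hb).le
  have hne : ∀ x ∈ L, decide (x ≠ n) = true := fun x hx => by
    simpa using (hL x hx).ne
  rw [stackSort]
  split
  · rename_i h
    rw [h] at hmax
    cases hmax
  · rename_i n' h
    rw [h] at hmax
    obtain rfl : n' = n := by simpa using hmax
    rw [List.takeWhile_append_of_pos hne, List.dropWhile_append_of_pos hne]
    simp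

theorem exists_max_split {w : List ℕ} (hw : w.Nodup) (hne : w ≠ []) :
    ∃ L n R, w = L ++ n :: R ∧ (∀ x ∈ L, x < n) ∧ ∀ x ∈ R, x < n := by
  cases hm : w.max? with
  | none => exact absurd (List.max?_eq_none_iff.1 hm) hne
  | some n =>
    obtain ⟨h1, h2⟩ := List.max?_eq_some_iff.1 hm
    obtain ⟨L, R, rfl⟩ := List.append_of_mem h1
    have hn := (List.nodup_middle.1 hw)
    rw [List.nodup_cons] at hn
    refine ⟨L, n, R, rfl, fun x hx => ?_, fun x hx => ?_⟩
    · refine lt_of_le_of_ne (h2 x (by simp [hx])) ?_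
      rintro rfl
      exact hn.1 (by simp [hx])
    · refine lt_of_le_of_ne (h2 x (by simp [hx])) ?_
      rintro rfl
      exact hn.1 (by simp [hx])

theorem stackSort_perm {w : List ℕ} (hw : w.Nodup) : (stackSort w).Perm w := by
  induction hl : w.length using Nat.strong_induction_on generalizing w with
  | _ N ih =>
    by_cases hne : w = []
    · rw [hne, stackSort_nil]
    · obtain ⟨L, n, R, rfl, hL, hR⟩ := exists_max_split hw hne
      simp only [List.length_append, List.length_cons] at hl
      have h1 := ih L.length (by omega) (hw.sublist (List.sublist_append_left _ _)) rfl
      have h2 := ih R.length (by omega) (hw.sublist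
        ((List.sublist_cons_self _ _).trans (List.sublist_append_right _ _))) rfl
      rw [stackSort_append_cons hL hR, List.append_assoc]
      exact h1.append ((List.perm_append_singleton _ _).trans (h2.cons n))

/-! ### Sorted words and the bound on their descents. -/

/-- `w` is sorted: it is the image of a permutation under the stack-sorting map. -/
def IsSorted (w : List ℕ) : Prop := ∃ v, IsPermWord v ∧ stackSort v = w

namespace IsSorted

theorem nil : IsSorted [] := ⟨[], ⟨List.nodup_nil, by simp⟩, stackSort_nil⟩

theorem join {α β : List ℕ} {m : ℕ} (hα : IsSorted α) (hβ : IsSorted β)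
    (hw : IsPermWord (α ++ β ++ [m])) (hm : ∀ x ∈ α ++ β, x < m) : IsSorted (α ++ β ++ [m]) := by
  obtain ⟨L, hL, rfl⟩ := hα
  obtain ⟨R, hR, rfl⟩ := hβ
  have h1 := stackSort_perm hL.1
  have h2 := stackSort_perm hR.1
  refine ⟨L ++ m :: R, hw.perm ?_, stackSort_append_cons (fun x hx => hm x ?_) fun x hx => hm x ?_⟩
  · rw [List.append_assoc]
    exact h1.symm.append ((h2.symm.cons m).trans (List.perm_append_singleton _ _).symm)
  · exact List.mem_append_left _ (h1.mem_iff.2 hx)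
  · exact List.mem_append_right _ (h2.mem_iff.2 hx)

theorem exists_split {w : List ℕ} (h : IsSorted w) (hne : w ≠ []) :
    ∃ α β m, w = α ++ β ++ [m] ∧ IsSorted α ∧ IsSorted β ∧ ∀ x ∈ α ++ β, x < m := by
  obtain ⟨v, hv, rfl⟩ := h
  have hv' : v ≠ [] := by
    rintro rfl
    exact hne stackSort_nil
  obtain ⟨L, n, R, rfl, hL, hR⟩ := exists_max_split hv.1 hv'
  have hLp := hv.sublist (List.sublist_append_left L (n :: R))
  have hRp := hv.sublist ((List.sublist_cons_self n R).trans (List.sublist_append_right L _))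
  refine ⟨_, _, n, stackSort_append_cons hL hR, ⟨L, hLp, rfl⟩, ⟨R, hRp, rfl⟩, fun x hx => ?_⟩
  rcases List.mem_append.1 hx with hx | hx
  · exact hL x ((stackSort_perm hLp.1).mem_iff.1 hx)
  · exact hR x ((stackSort_perm hRp.1).mem_iff.1 hx)

/-- In `s(L) s(R) n` only the junction can add a descent, and the two bounds together with the
letter `n` pay for it: `(2d₁ + 1) + (2d₂ + 1) + 1 = 2(d₁ + d₂ + 1) + 1`. -/
theorem desCount_le {w : List ℕ} (h : IsSorted w) (hne : w ≠ []) :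
    2 * desCount w + 1 ≤ w.length := by
  induction hl : w.length using Nat.strong_induction_on generalizing w with
  | _ N ih =>
    obtain ⟨α, β, m, rfl, hα, hβ, hm⟩ := h.exists_split hne
    rw [desCount_append_max hm]
    simp only [List.length_append, List.length_singleton] at hl
    by_cases h1 : α = []
    · subst h1
      by_cases h2 : β = []
      · subst h2
        simp at hl
        simp [desCount]
        omega
      · have := ih β.length (by omega) hβ h2 rfl
        simp at hl ⊢
        omega
    · have e1 := ih α.length (by omega) hα h1 rfl
      by_cases h2 : β = []
      · subst h2
        simp at hl ⊢
        omega
      · have e2 := ih β.length (by omega) hβ h2 rfl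
        have := desCount_append_le α β
        omega

/-- Equality in `desCount_le` forces, for a word of more than one letter, two nonempty balanced
factors and a descent at their junction. -/
theorem tightSorted {w : List ℕ} (h : IsSorted w) (hb : Balanced w) : TightSorted w := by
  induction hl : w.length using Nat.strong_induction_on generalizing w with
  | _ N ih =>
    have hne : w ≠ [] := by
      rintro rfl
      simp [Balanced] at hb
    obtain ⟨α, β, m, rfl, hα, hβ, hm⟩ := h.exists_split hne
    rw [Balanced, desCount_append_max hm] at hb
    simp only [List.length_append, List.length_singleton] at hl hb
    rcases List.eq_nil_or_concat' α with rfl | ⟨α, a, rfl⟩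
    · by_cases h2 : β = []
      · subst h2
        exact TightSorted.single m
      · have := hβ.desCount_le h2
        simp only [List.nil_append, List.length_nil] at hb
        omega
    · have e1 := hα.desCount_le (by simp)
      cases β with
      | nil =>
        simp only [List.append_nil, List.length_nil] at hb
        omega
      | cons b β =>
        have e2 := hβ.desCount_le (by simp)
        have e3 := desCount_append_cons_cons α a b β
        rw [append_cons_cons_eq] at e3
        split_ifs at e3 with hba
        · rw [← append_cons_cons_eq] at hm ⊢
          exact TightSorted.join (ih _ (by omega) hα (by rw [Balanced]; omega) rfl)
            (ih _ (by omega) hβ (by rw [Balanced]; omega) rfl) hba hm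
        · omega

/-- With `β = β₁ β₂ m`, the word `α` is absorbed into `β₁`, or into `β₂` if `β₁` is empty, by
recursion; the first letter of `β` keeps `α` below `m`. This supplies a second preimage when a
junction is not a descent. -/
theorem append {α β : List ℕ} (hα : IsSorted α) (hβ : IsSorted β) (hw : IsPermWord (α ++ β))
    (hlt : ∀ b ∈ β.head?, ∀ a ∈ α, a < b) : IsSorted (α ++ β) := by
  induction hl : β.length using Nat.strong_induction_on generalizing α β with
  | _ N ih =>
    by_cases hne : β = []
    · rwa [hne, List.append_nil]
    obtain ⟨β₁, β₂, m, rfl, h1, h2, hm⟩ := hβ.exists_split hne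
    simp only [List.length_append, List.length_singleton] at hl
    have hαm : ∀ a ∈ α, a < m := by
      intro a ha
      cases h : β₁ ++ β₂ with
      | nil => exact hlt m (by simp [h]) a ha
      | cons b γ => exact (hlt b (by simp [h]) a ha).trans (hm b (by simp [h]))
    have hm' : ∀ x ∈ α ++ (β₁ ++ β₂), x < m := by
      intro x hx
      rcases List.mem_append.1 hx with hx | hx
      · exact hαm x hx
      · exact hm x hx
    by_cases hβ₁ : β₁ = []
    · subst hβ₁
      have hs : IsSorted (α ++ β₂) := by
        refine ih β₂.length (by simp at hl; omega) hα h2 (hw.sublist (by simp)) ?_ rfl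
        intro b hb
        refine hlt b ?_
        cases β₂ with
        | nil => simp at hb
        | cons c β₂ => simpa using hb
      have := hs.join nil (m := m) (by simpa using hw) (by simpa using hm')
      simpa using this
    · have hs : IsSorted (α ++ β₁) := by
        refine ih β₁.length (by omega) hα h1 (hw.sublist (by simp)) ?_ rfl
        intro b hb
        refine hlt b ?_
        cases β₁ with
        | nil => simp at hb
        | cons c β₂ => simpa using hb
      have := hs.join h2 (m := m) (by simpa using hw) (by simpa using hm')
      simpa using this

end IsSorted

/-! ### Fertility one and tightness. -/

theorem fertility_eq_one_iff {w : List ℕ} :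
    fertility w = 1 ↔ ∃ v, IsPermWord v ∧ stackSort v = w ∧
      ∀ v', IsPermWord v' → stackSort v' = w → v' = v := by
  rw [fertility, Set.ncard_eq_one]
  constructor
  · rintro ⟨v, hv⟩
    have h1 : v ∈ ({v} : Set (List ℕ)) := rfl
    rw [← hv] at h1
    refine ⟨v, h1.1, h1.2, fun v' h2 h3 => ?_⟩
    have h4 : v' ∈ ({v} : Set (List ℕ)) := hv ▸ ⟨h2, h3⟩
    exact h4
  · rintro ⟨v, h1, h2, h3⟩
    refine ⟨v, Set.ext fun v' => ⟨fun h => h3 v' h.1 h.2, ?_⟩⟩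
    rintro rfl
    exact ⟨h1, h2⟩

/-- Descent counting shows that the images of the two halves of any preimage are tight and meet in a
descent. Then `split_unique` fixes the cut and induction fixes the halves. -/
theorem TightSorted.fertility_eq_one {w : List ℕ} (h : TightSorted w) (hw : IsPermWord w) :
    fertility w = 1 := by
  induction h with
  | single x =>
    refine fertility_eq_one_iff.2 ⟨[x], hw, ?_, fun v hv h => ?_⟩
    · simpa [stackSort_nil] using stackSort_append_cons (L := []) (n := x) (R := []) (by simp) (by simp)
    · have := stackSort_perm hv.1
      rw [h] at this
      exact List.perm_singleton.1 this.symm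
  | @join α a b β m h1 h2 hba hm ih1 ih2 =>
    have hw1 : IsPermWord (α ++ [a]) := hw.sublist (by simp)
    have hw2 : IsPermWord (b :: β) := hw.sublist (by
      rw [append_cons_cons_eq, List.append_assoc]
      exact (List.sublist_append_left _ _).trans (List.sublist_append_right _ _))
    obtain ⟨L, hL, hLs, hLu⟩ := fertility_eq_one_iff.1 (ih1 hw1)
    obtain ⟨R, hR, hRs, hRu⟩ := fertility_eq_one_iff.1 (ih2 hw2)
    have hLR := append_cons_cons_eq α a b β
    have hsort : IsSorted (α ++ a :: b :: β ++ [m]) := by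
      rw [hLR] at hw hm ⊢
      exact IsSorted.join ⟨L, hL, hLs⟩ ⟨R, hR, hRs⟩ hw hm
    have huniq : ∀ v, IsPermWord v → stackSort v = α ++ a :: b :: β ++ [m] → v = L ++ m :: R := by
      intro v hv hvs
      have hv' : v ≠ [] := by
        rintro rfl
        rw [stackSort_nil] at hvs
        simp at hvs
      obtain ⟨L', n, R', rfl, hL', hR'⟩ := exists_max_split hv.1 hv'
      have hLp := hv.sublist (List.sublist_append_left L' (n :: R'))
      have hRp := hv.sublist ((List.sublist_cons_self n R').trans (List.sublist_append_right L' _))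
      rw [stackSort_append_cons hL' hR'] at hvs
      obtain ⟨h3, h4⟩ := List.append_inj' hvs rfl
      obtain rfl : n = m := by simpa using h4
      have hsL : IsSorted (stackSort L') := ⟨L', hLp, rfl⟩
      have hsR : IsSorted (stackSort R') := ⟨R', hRp, rfl⟩
      have hbal := (join h1 h2 hba hm).balanced
      rw [Balanced, desCount_append_max hm, ← h3] at hbal
      simp only [List.length_append, List.length_singleton] at hbal
      -- With an empty half, the other image would have all the descents and one letter too few for
      -- a sorted word.
      rcases List.eq_nil_or_concat' (stackSort L') with hl | ⟨α', a', hl⟩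
      · have hne : stackSort R' ≠ [] := by
          intro hr
          rw [hl, hr] at h3
          simp at h3
        have := hsR.desCount_le hne
        rw [hl] at hbal
        simp only [List.nil_append, List.length_nil] at hbal
        omega
      have e1 := hsL.desCount_le (by simp [hl])
      cases hr : stackSort R' with
      | nil =>
        rw [hr] at hbal
        simp only [List.append_nil, List.length_nil] at hbal
        omega
      | cons b' β' =>
        have e2 := hsR.desCount_le (by simp [hr])
        have e3 := desCount_append_cons_cons α' a' b' β'
        rw [append_cons_cons_eq, ← hl, ← hr] at e3
        split_ifs at e3 with hba'
        · have t1 := hsL.tightSorted (by rw [Balanced]; omega)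
          have t2 := hsR.tightSorted (by rw [Balanced]; omega)
          rw [hl] at t1
          rw [hr] at t2
          obtain ⟨q1, q2, q3, q4⟩ := split_unique h1 h2 hba t1 t2 hba'
            (by rw [← h3, append_cons_cons_eq α' a', hl, hr])
          rw [hLu L' hLp (by rw [hl, q1, q2]), hRu R' hRp (by rw [hr, q3, q4])]
        · omega
    obtain ⟨v, hv, hvs⟩ := hsort
    refine fertility_eq_one_iff.2 ⟨L ++ m :: R, ?_, ?_, huniq⟩
    · exact huniq v hv hvs ▸ hv
    · exact huniq v hv hvs ▸ hvs

/-- For the unique preimage `L n R`, a lone empty half could trade places with the other half. If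
the junction were not a descent, `s(L) s(R)` would itself be sorted, and a preimage of it followed
by `n` would be a second preimage. -/
theorem tightSorted_of_fertility_eq_one {w : List ℕ} (h : fertility w = 1) (hne : w ≠ []) :
    TightSorted w := by
  induction hl : w.length using Nat.strong_induction_on generalizing w with
  | _ N ih =>
    obtain ⟨v, hv, rfl, hu⟩ := fertility_eq_one_iff.1 h
    have hv' : v ≠ [] := by
      rintro rfl
      exact hne stackSort_nil
    obtain ⟨L, n, R, rfl, hL, hR⟩ := exists_max_split hv.1 hv'
    have hLp := hv.sublist (List.sublist_append_left L (n :: R))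
    have hRp := hv.sublist ((List.sublist_cons_self n R).trans (List.sublist_append_right L _))
    have hpL := stackSort_perm hLp.1
    have hpR := stackSort_perm hRp.1
    have hsL : IsSorted (stackSort L) := ⟨L, hLp, rfl⟩
    have hsR : IsSorted (stackSort R) := ⟨R, hRp, rfl⟩
    -- Uniqueness of the preimage with the largest letter removed: `L' n R'` would be sorted to the
    -- same word.
    have key : ∀ L' R', IsPermWord L' → IsPermWord R' →
        stackSort L' ++ stackSort R' = stackSort L ++ stackSort R → L' = L ∧ R' = R := by
      intro L' R' hL' hR' heq
      have hp : (L' ++ R').Perm (L ++ R) := ((stackSort_perm hL'.1).append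
        (stackSort_perm hR'.1)).symm.trans (heq ▸ hpL.append hpR)
      have hlt : ∀ x ∈ L' ++ R', x < n := by
        intro x hx
        rcases List.mem_append.1 (hp.mem_iff.1 hx) with hx | hx
        · exact hL x hx
        · exact hR x hx
      have hlt1 : ∀ x ∈ L', x < n := fun x hx => hlt x (List.mem_append_left _ hx)
      have hlt2 : ∀ x ∈ R', x < n := fun x hx => hlt x (List.mem_append_right _ hx)
      have := hu (L' ++ n :: R') (hv.perm (List.perm_middle.trans
        ((hp.cons n).trans List.perm_middle.symm))) (by
          rw [stackSort_append_cons hlt1 hlt2, stackSort_append_cons hL hR, heq])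
      have hnL : n ∉ L := fun h => lt_irrefl _ (hL n h)
      have hnL' : n ∉ L' := fun h => lt_irrefl _ (hlt1 n h)
      rcases List.append_eq_append_iff.1 this with ⟨as, h1, h2⟩ | ⟨as, h1, h2⟩
      · cases as with
        | nil =>
          simp at h1 h2
          exact ⟨h1.symm, h2⟩
        | cons c as =>
          rw [List.cons_append, List.cons.injEq] at h2
          exact absurd (by rw [h1, h2.1]; simp) hnL
      · cases as with
        | nil =>
          simp at h1 h2
          exact ⟨h1, h2.symm⟩
        | cons c as =>
          rw [List.cons_append, List.cons.injEq] at h2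
          exact absurd (by rw [h1, h2.1]; simp) hnL'
    have hnil : IsPermWord [] := ⟨List.nodup_nil, by simp⟩
    rw [stackSort_append_cons hL hR] at hl ⊢
    simp only [List.length_append, List.length_singleton] at hl
    have hlt : ∀ x ∈ stackSort L ++ stackSort R, x < n := by
      intro x hx
      rcases List.mem_append.1 hx with hx | hx
      · exact hL x (hpL.mem_iff.1 hx)
      · exact hR x (hpR.mem_iff.1 hx)
    by_cases hLn : L = []
    · have := (key R [] hRp hnil (by rw [hLn, stackSort_nil, List.append_nil, List.nil_append])).2
      rw [hLn, ← this, stackSort_nil]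
      exact TightSorted.single n
    by_cases hRn : R = []
    · have := (key [] L hnil hLp (by rw [hRn, stackSort_nil, List.append_nil, List.nil_append])).1
      exact absurd this.symm hLn
    have hLne : stackSort L ≠ [] := fun h => hLn (by rw [h] at hpL; exact List.nil_perm.1 hpL)
    have hRne : stackSort R ≠ [] := fun h => hRn (by rw [h] at hpR; exact List.nil_perm.1 hpR)
    have t1 : TightSorted (stackSort L) := by
      refine ih _ (by omega) (fertility_eq_one_iff.2 ⟨L, hLp, rfl, fun L' hL' h => ?_⟩) hLne rfl
      exact (key L' R hL' hRp (by rw [h])).1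
    have t2 : TightSorted (stackSort R) := by
      refine ih _ (by omega) (fertility_eq_one_iff.2 ⟨R, hRp, rfl, fun R' hR' h => ?_⟩) hRne rfl
      exact (key L R' hLp hR' (by rw [h])).2
    have hperm : IsPermWord (stackSort L ++ stackSort R) :=
      (hv.sublist ((List.sublist_cons_self n R).append_left L)).perm (hpL.append hpR)
    have hnapp : ¬ IsSorted (stackSort L ++ stackSort R) := by
      rintro ⟨v, hv1, hv2⟩
      exact hRn (key v [] hv1 hnil (by rw [hv2, stackSort_nil, List.append_nil])).2.symm
    obtain ⟨α, a, hα, hαa⟩ := t1.exists_last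
    cases hβ : stackSort R with
    | nil => exact absurd hβ hRne
    | cons b β =>
      have hba : b < a := by
        by_contra hba
        refine hnapp (hsL.append hsR hperm fun c hc x hx => ?_)
        obtain rfl : b = c := by simpa [hβ] using hc
        have hne : x ≠ b := by
          rintro rfl
          exact (List.nodup_append.1 hperm.1).2.2 x hx x (by simp [hβ]) rfl
        rw [hα] at hx
        rcases List.mem_append.1 hx with hx | hx
        · have := hαa x hx
          omega
        · obtain rfl : x = a := by simpa using hx
          omega
      rw [hα] at t1
      rw [hβ] at t2
      rw [hα, hβ, ← append_cons_cons_eq] at hlt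
      rw [hα, ← append_cons_cons_eq]
      exact TightSorted.join t1 t2 hba hlt

/-! ### The canonical hook configuration of a tight word -/

/-- Each hook is determined by the hooks to its right, so the induction runs from right to left. -/
theorem IsCanonicalHookConfiguration.eq {w : List ℕ} {N N' : ℕ → ℕ}
    (h : IsCanonicalHookConfiguration w N) (h' : IsCanonicalHookConfiguration w N') {d : ℕ}
    (hd : IsDescent w d) : N d = N' d := by
  induction hl : w.length - d using Nat.strong_induction_on generalizing d with
  | _ n ih =>
    have key : ∀ d', IsDescent w d' → d < d' → N d' = N' d' := by
      intro d' hd' hlt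
      have := hd.1
      exact ih _ (by omega) hd' rfl
    obtain ⟨⟨h1, h2, h3, h4⟩, h5⟩ := h' d hd
    refine (h d hd).unique ⟨⟨h1, h2, h3, fun d' hd' hlt => ?_⟩, fun j hj => ?_⟩
    · rw [key d' hd' hlt]
      exact h4 d' hd' hlt
    · refine h5 ⟨hj.1, hj.2.1, hj.2.2.1, fun d' hd' hlt => ?_⟩
      rw [← key d' hd' hlt]
      exact hj.2.2.2 d' hd' hlt

/-- `N` is the canonical hook configuration of `w`, and every point but the first one lies weakly
below one of its hooks. -/
def IsHookCover (w : List ℕ) (N : ℕ → ℕ) : Prop :=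
  IsCanonicalHookConfiguration w N ∧
    ∀ r, 0 < r → r < w.length → ∃ d, IsDescent w d ∧ WeaklyBelow w r d (N d)

/-- The hook from `a` has to reach `m`: `b` is too low, and all later points of `b β` lie weakly
below hooks of `b β`. This is why the covering property is carried through the induction. Hooks of
`α a` are unaffected, since hooks that start at `a` or later cover none of its points; hooks of `b
β` are shifted by `p + 1`. -/
theorem exists_isHookCover_join {α : List ℕ} {a b : ℕ} {β : List ℕ} {m : ℕ} (hba : b < a)
    (hm : ∀ x ∈ α ++ a :: b :: β, x < m) {N₁ N₂ : ℕ → ℕ} (h₁ : IsHookCover (α ++ [a]) N₁)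
    (h₂ : IsHookCover (b :: β) N₂) :
    ∃ N, IsHookCover (α ++ a :: b :: β ++ [m]) N ∧ IsDescent (α ++ a :: b :: β ++ [m]) α.length ∧
      N α.length = α.length + 2 + β.length := by
  obtain ⟨c₁, g₁⟩ := h₁
  obtain ⟨c₂, g₂⟩ := h₂
  obtain ⟨p, hp⟩ : ∃ p, p = α.length := ⟨_, rfl⟩
  obtain ⟨q, hq⟩ : ∃ q, q = β.length := ⟨_, rfl⟩
  have hA : (α ++ [a]).length = p + 1 := by simp [hp]
  have hB : (b :: β).length = q + 1 := by simp [hq]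
  have hw : (α ++ a :: b :: β ++ [m]).length = p + q + 3 := by simp [hp, hq]; omega
  have hsplit : α ++ a :: b :: β ++ [m] = (α ++ [a]) ++ ((b :: β) ++ [m]) := by simp
  have v₁ : ∀ i ≤ p, (α ++ a :: b :: β ++ [m]).getD i 0 = (α ++ [a]).getD i 0 := by
    intro i hi
    rw [hsplit, List.getD_append _ _ _ _ (by omega)]
  have v₂ : ∀ i ≤ q, (α ++ a :: b :: β ++ [m]).getD (p + 1 + i) 0 = (b :: β).getD i 0 := by
    intro i hi
    rw [hsplit, List.getD_append_right _ _ _ _ (by omega), List.getD_append _ _ _ _ (by omega)]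
    congr 1
    omega
  have vl : (α ++ a :: b :: β ++ [m]).getD (p + q + 2) 0 = m := by
    rw [List.getD_append_right _ _ _ _ (by simp; omega)]
    simp [hp, hq]
    rw [show α.length + β.length + 2 - (α.length + (β.length + 1 + 1)) = 0 by omega]
    simp
  have vp : (α ++ a :: b :: β ++ [m]).getD p 0 = a := by
    rw [v₁ p le_rfl, hp]
    simp
  have vb : (α ++ a :: b :: β ++ [m]).getD (p + 1) 0 = b := by
    rw [v₂ 0 (by omega)]
    rfl
  have vm : ∀ i < p + q + 2, (α ++ a :: b :: β ++ [m]).getD i 0 < m := by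
    intro i hi
    have hi' : i < (α ++ a :: b :: β).length := by simp; omega
    rw [List.getD_append _ _ _ _ hi', List.getD_eq_getElem _ _ hi']
    exact hm _ (List.getElem_mem _)
  have e₁ : ∀ d < p, IsDescent (α ++ a :: b :: β ++ [m]) d ↔ IsDescent (α ++ [a]) d := by
    intro d hd
    rw [IsDescent, IsDescent, v₁ d (by omega), v₁ (d + 1) (by omega), hA, hw]
    exact and_congr_left' ⟨fun _ => by omega, fun _ => by omega⟩
  have e₂ : ∀ d, IsDescent (α ++ a :: b :: β ++ [m]) (p + 1 + d) ↔ IsDescent (b :: β) d := by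
    intro d
    rw [IsDescent, IsDescent, hB, hw]
    constructor
    · rintro ⟨h1, h2⟩
      by_cases hd : d + 1 = q + 1
      · rw [show p + 1 + d + 1 = p + q + 2 by omega, vl] at h2
        have := vm (p + 1 + d) (by omega)
        omega
      · rw [v₂ d (by omega), add_assoc, v₂ (d + 1) (by omega)] at h2
        exact ⟨by omega, h2⟩
    · rintro ⟨h1, h2⟩
      rw [v₂ d (by omega), add_assoc, v₂ (d + 1) (by omega)]
      exact ⟨by omega, h2⟩
  have ep : IsDescent (α ++ a :: b :: β ++ [m]) p := by
    rw [IsDescent, vp, vb, hw]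
    exact ⟨by omega, hba⟩
  obtain ⟨N, n₁, np, n₂⟩ : ∃ N : ℕ → ℕ, (∀ d < p, N d = N₁ d) ∧ N p = p + q + 2 ∧
      ∀ d, N (p + 1 + d) = p + 1 + N₂ d := by
    refine ⟨fun d => if d < p then N₁ d else if d = p then p + q + 2 else p + 1 + N₂ (d - (p + 1)),
      fun d hd => if_pos hd, ?_, fun d => ?_⟩
    · simp
    · simp only
      rw [if_neg (by omega), if_neg (by omega)]
      congr 2
      omega
  have b₁ : ∀ d, IsDescent (α ++ [a]) d → d < N₁ d ∧ N₁ d ≤ p := by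
    intro d hd
    have h1 := (c₁ d hd).1.1
    have h2 := (c₁ d hd).1.2.1
    omega
  have b₂ : ∀ d, IsDescent (b :: β) d → d < N₂ d ∧ N₂ d ≤ q := by
    intro d hd
    have h1 := (c₂ d hd).1.1
    have h2 := (c₂ d hd).1.2.1
    omega
  have w₁ : ∀ r ≤ p, ∀ d, IsDescent (α ++ [a]) d →
      (WeaklyBelow (α ++ a :: b :: β ++ [m]) r d (N₁ d) ↔ WeaklyBelow (α ++ [a]) r d (N₁ d)) := by
    intro r hr d hd
    rw [WeaklyBelow, WeaklyBelow, v₁ r hr, v₁ _ (b₁ d hd).2]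
  have w₂ : ∀ r ≤ q, ∀ d, IsDescent (b :: β) d →
      (WeaklyBelow (α ++ a :: b :: β ++ [m]) (p + 1 + r) (p + 1 + d) (p + 1 + N₂ d) ↔
        WeaklyBelow (b :: β) r d (N₂ d)) := by
    intro r hr d hd
    rw [WeaklyBelow, WeaklyBelow, v₂ r hr, v₂ _ (b₂ d hd).2]
    simp only [Nat.add_lt_add_iff_left, Nat.add_left_cancel_iff]
  rw [← hp, ← hq]
  refine ⟨N, ⟨?_, ?_⟩, ep, by rw [np]; omega⟩
  · intro d hd
    rcases lt_trichotomy d p with hdp | rfl | hdp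
    · rw [n₁ d hdp]
      have hd' := (e₁ d hdp).1 hd
      obtain ⟨⟨k1, k2, k3, k4⟩, k5⟩ := c₁ d hd'
      have k6 := (b₁ d hd').2
      refine ⟨⟨k1, by omega, by rwa [v₁ d hdp.le, v₁ _ k6], fun d' h1 h2 h3 => ?_⟩, ?_⟩
      · rcases lt_trichotomy d' p with hd'p | rfl | hd'p
        · rw [n₁ d' hd'p] at h3
          have h4 := (e₁ d' hd'p).1 h1
          exact k4 d' h4 h2 ((w₁ _ k6 d' h4).1 h3)
        · rw [np] at h3
          rcases h3 with h3 | h3 <;> omega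
        · obtain ⟨e, rfl⟩ := Nat.exists_eq_add_of_le hd'p
          rw [n₂] at h3
          rcases h3 with h3 | h3 <;> omega
      · rintro j ⟨h1, h2, h3, h4⟩
        by_cases hj : j ≤ p
        · refine k5 ⟨h1, by omega, by rwa [v₁ d hdp.le, v₁ _ hj] at h3, fun d' h5 h6 h7 => ?_⟩
          have hd'p : d' < p := by have := h5.1; omega
          refine h4 d' ((e₁ d' hd'p).2 h5) h6 ?_
          rw [n₁ d' hd'p]
          exact (w₁ j hj d' h5).2 h7
        · omega
    · rw [np]
      refine ⟨⟨by omega, by omega, by rw [vp, vl]; exact hm a (by simp), fun d' h1 h2 h3 => ?_⟩, ?_⟩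
      · obtain ⟨e, rfl⟩ := Nat.exists_eq_add_of_le h2
        have := b₂ e ((e₂ e).1 h1)
        have h4 := n₂ e
        change N (d + 1 + e) = d + 1 + N₂ e at h4
        simp only [Nat.succ_eq_add_one] at h3
        rw [h4] at h3
        rcases h3 with h3 | h3 <;> omega
      · rintro j ⟨h1, h2, h3, h4⟩
        obtain ⟨i, rfl⟩ := Nat.exists_eq_add_of_le (show d + 1 ≤ j from h1)
        by_contra hlt
        have hi : i ≤ q := by omega
        by_cases hi0 : i = 0
        · subst hi0
          rw [add_zero, vb, vp] at h3
          omega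
        · obtain ⟨e, he1, he2⟩ := g₂ i (by omega) (by omega)
          refine h4 (d + 1 + e) ((e₂ e).2 he1) (by omega) ?_
          rw [n₂]
          exact (w₂ i hi e he1).2 he2
    · obtain ⟨e, rfl⟩ := Nat.exists_eq_add_of_le (show p + 1 ≤ d from hdp)
      have he := (e₂ e).1 hd
      obtain ⟨⟨k1, k2, k3, k4⟩, k5⟩ := c₂ e he
      have k6 := (b₂ e he).2
      rw [n₂]
      refine ⟨⟨by omega, by omega, ?_, fun d' h1 h2 h3 => ?_⟩, ?_⟩
      · rwa [v₂ e (by omega), v₂ _ k6]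
      · obtain ⟨e', rfl⟩ := Nat.exists_eq_add_of_le (show p + 1 ≤ d' by omega)
        rw [n₂] at h3
        have h4 := (e₂ e').1 h1
        exact k4 e' h4 (by omega) ((w₂ _ k6 e' h4).1 h3)
      · rintro j ⟨h1, h2, h3, h4⟩
        obtain ⟨i, rfl⟩ := Nat.exists_eq_add_of_le (show p + 1 ≤ j by omega)
        by_cases hi : i ≤ q
        · have := k5 (a := i) ⟨by omega, by omega, by rwa [v₂ e (by omega), v₂ i hi] at h3,
            fun d' h5 h6 h7 => ?_⟩
          · omega
          · refine h4 (p + 1 + d') ((e₂ d').2 h5) (by omega) ?_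
            rw [n₂]
            exact (w₂ i hi d' h5).2 h7
        · omega
  · intro r hr0 hr
    by_cases hrp : r ≤ p
    · obtain ⟨d, hd1, hd2⟩ := g₁ r hr0 (by omega)
      have hdp : d < p := by have := hd1.1; omega
      refine ⟨d, (e₁ d hdp).2 hd1, ?_⟩
      rw [n₁ d hdp]
      exact (w₁ r hrp d hd1).2 hd2
    · refine ⟨p, ep, ?_⟩
      rw [np]
      by_cases hrl : r = p + q + 2
      · exact Or.inr hrl
      · left
        rw [vl]
        exact ⟨by omega, by omega, vm r (by omega)⟩

theorem TightSorted.exists_isHookCover {w : List ℕ} (h : TightSorted w) : ∃ N, IsHookCover w N := by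
  induction h with
  | single x =>
    refine ⟨id, fun d hd => ?_, fun r h1 h2 => ?_⟩
    · have := hd.1
      simp at this
    · simp only [List.length_singleton] at h2
      omega
  | join h1 h2 hba hm ih1 ih2 =>
    obtain ⟨N₁, hN₁⟩ := ih1
    obtain ⟨N₂, hN₂⟩ := ih2
    obtain ⟨N, hN, -⟩ := exists_isHookCover_join hba hm hN₁ hN₂
    exact ⟨N, hN⟩

/-- A northeast endpoint lies weakly below its own hook, so two hooks never share one. The hook
ending at `m` is thus the one from `a`, and the partner of `m` is `b`. -/
theorem wordGenerates_join_iff {α : List ℕ} {a b : ℕ} {β : List ℕ} {m : ℕ}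
    (h1 : TightSorted (α ++ [a])) (h2 : TightSorted (b :: β)) (hba : b < a)
    (hm : ∀ x ∈ α ++ a :: b :: β, x < m) {π : List ℕ} :
    WordGenerates π (α ++ a :: b :: β ++ [m]) ↔ π = normalize (α ++ a :: β) := by
  obtain ⟨N₁, hN₁⟩ := h1.exists_isHookCover
  obtain ⟨N₂, hN₂⟩ := h2.exists_isHookCover
  obtain ⟨N, ⟨hN, -⟩, hdesc, hlast⟩ := exists_isHookCover_join hba hm hN₁ hN₂
  have hl : (α ++ a :: b :: β).length = α.length + 2 + β.length := by simp; omega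
  have herase : ((α ++ a :: b :: β ++ [m]).eraseIdx (α.length + 2 + β.length)).eraseIdx
      (α.length + 1) = α ++ a :: β := by
    rw [← hl, List.eraseIdx_append_of_length_le le_rfl, Nat.sub_self, List.eraseIdx_cons_zero,
      List.append_nil, List.eraseIdx_append_of_length_le (by omega)]
    simp
  have hget : (α ++ a :: b :: β ++ [m]).getD (α.length + 2 + β.length) 0 = m := by
    rw [← hl, List.getD_append_right _ _ _ _ le_rfl]
    simp
  constructor
  · rintro ⟨N', d, hN', hd, hmax, rfl⟩
    have hmem := (hN' d hd).1
    have hNd : N' d = α.length + 2 + β.length := by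
      by_contra hne
      have hlt : N' d < (α ++ a :: b :: β).length := by
        have := hmem.2.1
        rw [List.length_append, List.length_singleton] at this
        omega
      have h3 := hmax m (by simp)
      rw [List.getD_append _ _ _ _ hlt, List.getD_eq_getElem _ _ hlt] at h3
      have := hm _ (List.getElem_mem hlt)
      omega
    have hNd' : N' α.length = α.length + 2 + β.length := by rw [hN'.eq hN hdesc, hlast]
    have hdα : d = α.length := by
      rcases lt_trichotomy d α.length with h | h | h
      · exact absurd (Or.inr (hNd.trans hNd'.symm)) (hmem.2.2.2 _ hdesc h)
      · exact h
      · exact absurd (Or.inr (hNd'.trans hNd.symm)) ((hN' _ hdesc).1.2.2.2 _ hd h)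
    rw [hNd, hdα, herase]
  · rintro rfl
    refine ⟨N, α.length, hN, hdesc, ?_, by rw [hlast, herase]⟩
    intro x hx
    rw [hlast, hget]
    rcases List.mem_append.1 hx with hx | hx
    · exact (hm x hx).le
    · exact (List.mem_singleton.1 hx).le

/-! ### Normalization and pattern avoidance -/

theorem mem_symm_iff {n : ℕ} {w : List ℕ} :
    w ∈ symm n ↔ w.Nodup ∧ ∀ x, x ∈ w ↔ 1 ≤ x ∧ x ≤ n := by
  constructor
  · intro h
    have h : w.Perm (List.range' 1 n) := h
    refine ⟨h.nodup_iff.2 List.nodup_range', fun x => ?_⟩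
    rw [h.mem_iff, List.mem_range'_1]
    omega
  · rintro ⟨h1, h2⟩
    refine (List.perm_ext_iff_of_nodup h1 List.nodup_range').2 fun x => ?_
    rw [h2, List.mem_range'_1]
    omega

theorem length_of_mem_symm {n : ℕ} {w : List ℕ} (h : w ∈ symm n) : w.length = n := by
  have h : w.Perm (List.range' 1 n) := h
  rw [h.length_eq, List.length_range']

theorem isPermWord_of_mem_symm {n : ℕ} {w : List ℕ} (h : w ∈ symm n) : IsPermWord w :=
  ⟨(mem_symm_iff.1 h).1, fun x hx => (((mem_symm_iff.1 h).2 x).1 hx).1⟩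

theorem countP_range' (n x : ℕ) :
    (List.range' 1 n).countP (fun y => decide (y ≤ x)) = min x n := by
  induction n with
  | zero => simp
  | succ n ih =>
    rw [List.range'_1_concat, List.countP_append, ih, List.countP_singleton]
    simp only [decide_eq_true_eq]
    split_ifs <;> omega

theorem normalize_eq_self {n : ℕ} {w : List ℕ} (h : w ∈ symm n) : normalize w = w := by
  have hp : w.Perm (List.range' 1 n) := h
  rw [normalize]
  conv_rhs => rw [← List.map_id w]
  refine List.map_congr_left fun x hx => ?_
  rw [hp.countP_eq, countP_range', id, min_eq_left (((mem_symm_iff.1 h).2 x).1 hx).2]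

theorem normalize_map {f : ℕ → ℕ} (hf : StrictMono f) (w : List ℕ) :
    normalize (w.map f) = normalize w := by
  rw [normalize, normalize, List.map_map]
  refine List.map_congr_left fun x _ => ?_
  rw [Function.comp_apply, List.countP_map]
  refine List.countP_congr fun y _ => ?_
  simp [hf.le_iff_le]

/-- `w` avoids `312`. -/
def Avoids312 (w : List ℕ) : Prop :=
  ∀ x y z, [x, y, z].Sublist w → ¬ (y < z ∧ z < x)

/-- `w` avoids `1342`. -/
def Avoids1342 (w : List ℕ) : Prop :=
  ∀ x y z t, [x, y, z, t].Sublist w → ¬ (x < t ∧ t < y ∧ y < z)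

theorem lt_of_countP_lt {v : List ℕ} {x y : ℕ}
    (h : v.countP (fun t => decide (t ≤ x)) < v.countP (fun t => decide (t ≤ y))) : x < y := by
  by_contra hxy
  refine absurd (List.countP_mono_left fun t _ ht => ?_) (not_le.2 h)
  simp only [decide_eq_true_eq] at ht ⊢
  omega

theorem not_containsPattern_312_iff {w : List ℕ} :
    ¬ ContainsPattern w [3, 1, 2] ↔ Avoids312 w := by
  have hp : normalize [3, 1, 2] = [3, 1, 2] := by simp [normalize]
  constructor
  · rintro h x y z hs ⟨h1, h2⟩
    refine h ⟨_, hs, ?_⟩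
    rw [hp]
    simp [normalize, h1.le, h2.le, (h1.trans h2).le, h1.not_ge, h2.not_ge,
      (h1.trans h2).not_ge]
  · rintro h ⟨v, hs, hv⟩
    have hlen := congrArg List.length hv
    rw [hp] at hv
    simp only [normalize, List.length_map, List.length_cons, List.length_nil] at hlen
    obtain ⟨x, y, z, rfl⟩ := List.length_eq_three.1 hlen
    simp only [normalize, List.map_cons, List.map_nil, List.cons.injEq, and_true] at hv
    obtain ⟨e1, e2, e3⟩ := hv
    exact h x y z hs ⟨lt_of_countP_lt (by rw [e2, e3]; omega), lt_of_countP_lt (by rw [e1, e3]; omega)⟩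

theorem not_containsPattern_1342_iff {w : List ℕ} :
    ¬ ContainsPattern w [1, 3, 4, 2] ↔ Avoids1342 w := by
  have hp : normalize [1, 3, 4, 2] = [1, 3, 4, 2] := by simp [normalize]
  constructor
  · rintro h x y z t hs ⟨h1, h2, h3⟩
    refine h ⟨_, hs, ?_⟩
    have h4 := h1.trans h2
    have h5 := h2.trans h3
    have h6 := h4.trans h3
    rw [hp]
    simp [normalize, h1.le, h2.le, h3.le, h4.le, h5.le, h6.le, h1.not_ge, h2.not_ge, h3.not_ge,
      h4.not_ge, h5.not_ge, h6.not_ge]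
  · rintro h ⟨v, hs, hv⟩
    have hlen := congrArg List.length hv
    rw [hp] at hv
    simp only [normalize, List.length_map, List.length_cons, List.length_nil] at hlen
    match v, hlen with
    | [x, y, z, t], _ =>
      simp only [normalize, List.map_cons, List.map_nil, List.cons.injEq, and_true] at hv
      obtain ⟨e1, e2, e3, e4⟩ := hv
      exact h x y z t hs ⟨lt_of_countP_lt (by rw [e1, e4]; omega),
        lt_of_countP_lt (by rw [e2, e4]; omega), lt_of_countP_lt (by rw [e2, e3]; omega)⟩

namespace Avoids312

theorem sublist {u w : List ℕ} (h : Avoids312 w) (hu : u.Sublist w) : Avoids312 u :=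
  fun x y z hs => h x y z (hs.trans hu)

theorem map_iff {f : ℕ → ℕ} (hf : StrictMono f) {w : List ℕ} :
    Avoids312 (w.map f) ↔ Avoids312 w := by
  constructor
  · intro h x y z hs
    have := h (f x) (f y) (f z) (hs.map f)
    rwa [hf.lt_iff_lt, hf.lt_iff_lt] at this
  · intro h x y z hs
    obtain ⟨l, hl, he⟩ := List.sublist_map_iff.1 hs
    have hlen := congrArg List.length he
    rw [List.length_map] at hlen
    obtain ⟨x', y', z', rfl⟩ := List.length_eq_three.1 hlen.symm
    simp only [List.map_cons, List.map_nil, List.cons.injEq, and_true] at he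
    obtain ⟨rfl, rfl, rfl⟩ := he
    rw [hf.lt_iff_lt, hf.lt_iff_lt]
    exact h x' y' z' hl

end Avoids312

namespace Avoids1342

theorem sublist {u w : List ℕ} (h : Avoids1342 w) (hu : u.Sublist w) : Avoids1342 u :=
  fun x y z t hs => h x y z t (hs.trans hu)

theorem map_iff {f : ℕ → ℕ} (hf : StrictMono f) {w : List ℕ} :
    Avoids1342 (w.map f) ↔ Avoids1342 w := by
  constructor
  · intro h x y z t hs
    have := h (f x) (f y) (f z) (f t) (hs.map f)
    rwa [hf.lt_iff_lt, hf.lt_iff_lt, hf.lt_iff_lt] at this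
  · intro h x y z t hs
    obtain ⟨l, hl, he⟩ := List.sublist_map_iff.1 hs
    have hlen := congrArg List.length he
    rw [List.length_map] at hlen
    match l, hlen with
    | [x', y', z', t'], _ =>
      simp only [List.map_cons, List.map_nil, List.cons.injEq, and_true] at he
      obtain ⟨rfl, rfl, rfl, rfl⟩ := he
      rw [hf.lt_iff_lt, hf.lt_iff_lt, hf.lt_iff_lt]
      exact h x' y' z' t' hl

end Avoids1342

theorem sublist_concat_cases {l v : List ℕ} {m : ℕ} (h : l.Sublist (v ++ [m])) :
    l.Sublist v ∨ ∃ l', l = l' ++ [m] ∧ l'.Sublist v := by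
  obtain ⟨l₁, l₂, rfl, h1, h2⟩ := List.sublist_append_iff.1 h
  rcases List.sublist_singleton.1 h2 with rfl | rfl
  · exact Or.inl (by simpa using h1)
  · exact Or.inr ⟨l₁, rfl, h1⟩

theorem sublist_middle_cases {l A B : List ℕ} {b : ℕ} (h : l.Sublist (A ++ b :: B)) :
    l.Sublist (A ++ B) ∨ ∃ l₁ l₂, l = l₁ ++ b :: l₂ ∧ l₁.Sublist A ∧ l₂.Sublist B := by
  obtain ⟨l₁, l₂, rfl, h1, h2⟩ := List.sublist_append_iff.1 h
  rcases List.sublist_cons_iff.1 h2 with h2 | ⟨r, rfl, h3⟩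
  · exact Or.inl (h1.append h2)
  · exact Or.inr ⟨l₁, r, rfl, h1, h3⟩

theorem pair_sublist {l : List ℕ} {x y : ℕ} (hx : x ∈ l) (hy : y ∈ l) (hne : x ≠ y) :
    [x, y].Sublist l ∨ [y, x].Sublist l := by
  obtain ⟨s, t, rfl⟩ := List.append_of_mem hx
  rcases List.mem_append.1 hy with hy | hy
  · exact Or.inr ((List.singleton_sublist.2 hy).append (List.singleton_sublist.2 (by simp)))
  · have hy : y ∈ t := (List.mem_cons.1 hy).resolve_left hne.symm
    exact Or.inl (((List.singleton_sublist.2 hy).cons_cons x).trans (List.sublist_append_right _ _))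

/-! ### Inserting and erasing the partner `b` of the highest point. -/

section Insert

variable {α β : List ℕ} {a b m : ℕ}

/-- The final maximum `m` cannot play the `2`. If `b` plays the `3`, then `a` can replace it; as the
`1` it would need a letter of `β` between `b` and `a`; as the `2` it would have letters of `α` on
both sides of its value. -/
theorem Avoids312.insert (hα : ∀ x ∈ α, x < a) (hba : b < a) (hβ : ∀ e ∈ β, e < a → e < b)
    (hb : (∀ x ∈ α, x < b) ∨ ∀ x ∈ α, b < x) (hm : ∀ x ∈ α ++ a :: b :: β, x < m)
    (h : Avoids312 (α ++ a :: β)) : Avoids312 (α ++ a :: b :: β ++ [m]) := by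
  rintro x y z hs ⟨hyz, hzx⟩
  have hle : ∀ t ∈ α ++ [a], t ≤ a := by
    intro t ht
    rcases List.mem_append.1 ht with ht | ht
    · exact (hα t ht).le
    · exact (List.mem_singleton.1 ht).le
  rcases sublist_concat_cases hs with hs | ⟨l, hl, hs'⟩
  · rw [append_cons_cons_eq] at hs
    rcases sublist_middle_cases hs with hs | ⟨l₁, l₂, hl, h1, h2⟩
    · exact h x y z (by simpa using hs) ⟨hyz, hzx⟩
    · rcases l₁ with _ | ⟨x', _ | ⟨y', _ | ⟨z', l₁⟩⟩⟩
      · simp only [List.nil_append, List.cons.injEq] at hl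
        obtain ⟨rfl, rfl⟩ := hl
        exact h a y z (((h2.cons_cons a)).trans (List.sublist_append_right _ _)) ⟨hyz, hzx.trans hba⟩
      · simp only [List.cons_append, List.nil_append, List.cons.injEq] at hl
        obtain ⟨rfl, rfl, rfl⟩ := hl
        have hx := hle x (h1.subset (by simp))
        have := hβ z (h2.subset (by simp)) (by omega)
        omega
      · simp only [List.cons_append, List.nil_append, List.cons.injEq] at hl
        obtain ⟨rfl, rfl, rfl, rfl⟩ := hl
        have hx : x ∈ α := by
          rcases sublist_concat_cases h1 with h1 | ⟨l', hl', h1⟩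
          · exact h1.subset (by simp)
          · obtain ⟨rfl, -⟩ := List.append_inj' (show [x] ++ [y] = l' ++ [a] from hl') rfl
            exact h1.subset (by simp)
        rcases hb with hb | hb
        · have := hb x hx
          omega
        · rcases List.mem_append.1 (h1.subset (show y ∈ [x, y] by simp)) with hy | hy
          · have := hb y hy
            omega
          · have := List.mem_singleton.1 hy
            omega
      · simp at hl
  · obtain ⟨rfl, hz⟩ := List.append_inj' (show [x, y] ++ [z] = l ++ [m] from hl) rfl
    obtain rfl : z = m := by simpa using hz
    have := hm x (hs'.subset (by simp))
    omega

/-- As `1`, `3` or `4` the letter `b` can be replaced by `a`, since letters of `β` above `b` are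
above `a`. As `2` it would have letters of `α` on both sides of its value. -/
theorem Avoids1342.insert (hα : ∀ x ∈ α, x < a) (hba : b < a) (hβ : ∀ e ∈ β, e < a → e < b)
    (haβ : a ∉ β) (hb : (∀ x ∈ α, x < b) ∨ ∀ x ∈ α, b < x) (hm : ∀ x ∈ α ++ a :: b :: β, x < m)
    (h : Avoids1342 (α ++ a :: β)) : Avoids1342 (α ++ a :: b :: β ++ [m]) := by
  rintro x y z t hs ⟨hxt, hty, hyz⟩
  have hgt : ∀ e ∈ β, b < e → a < e := by
    intro e he hbe
    by_contra hae
    have : e ≠ a := by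
      rintro rfl
      exact haβ he
    have := hβ e he (by omega)
    omega
  rcases sublist_concat_cases hs with hs | ⟨l, hl, hs'⟩
  · rw [append_cons_cons_eq] at hs
    rcases sublist_middle_cases hs with hs | ⟨l₁, l₂, hl, h1, h2⟩
    · exact h x y z t (by simpa using hs) ⟨hxt, hty, hyz⟩
    · have hmem : ∀ u ∈ α ++ [a], u < a → u ∈ α := by
        intro u hu hua
        rcases List.mem_append.1 hu with hu | hu
        · exact hu
        · have := List.mem_singleton.1 hu
          omega
      rcases l₁ with _ | ⟨x', _ | ⟨y', _ | ⟨z', _ | ⟨t', l₁⟩⟩⟩⟩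
      · simp only [List.nil_append, List.cons.injEq] at hl
        obtain ⟨rfl, rfl⟩ := hl
        exact h a y z t ((h2.cons_cons a).trans (List.sublist_append_right _ _))
          ⟨hgt t (h2.subset (by simp)) hxt, hty, hyz⟩
      · simp only [List.cons_append, List.nil_append, List.cons.injEq] at hl
        obtain ⟨rfl, rfl, rfl⟩ := hl
        have hz := hgt z (h2.subset (by simp)) hyz
        have hx : x ∈ α := hmem x (h1.subset (by simp)) (by omega)
        exact h x a z t ((List.singleton_sublist.2 hx).append (h2.cons_cons a)) ⟨hxt, by omega, hz⟩
      · simp only [List.cons_append, List.nil_append, List.cons.injEq] at hl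
        obtain ⟨rfl, rfl, rfl, rfl⟩ := hl
        have hs2 : [x, y].Sublist α := by
          rcases sublist_concat_cases h1 with h1 | ⟨l', hl', h1⟩
          · exact h1
          · obtain ⟨-, hy⟩ := List.append_inj' (show [x] ++ [y] = l' ++ [a] from hl') rfl
            have : y = a := by simpa using hy
            omega
        exact h x y a t (hs2.append (h2.cons_cons a)) ⟨hxt, hty, by omega⟩
      · simp only [List.cons_append, List.nil_append, List.cons.injEq] at hl
        obtain ⟨rfl, rfl, rfl, rfl, rfl⟩ := hl
        have hxy : [x, y].Sublist α := by
          rcases sublist_concat_cases h1 with h1 | ⟨l', hl', h1⟩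
          · exact (List.sublist_append_left [x, y] [z]).trans h1
          · obtain ⟨rfl, -⟩ := List.append_inj' (show [x, y] ++ [z] = l' ++ [a] from hl') rfl
            exact h1
        have hx := hxy.subset (show x ∈ [x, y] by simp)
        have hy := hxy.subset (show y ∈ [x, y] by simp)
        rcases hb with hb | hb
        · have := hb y hy
          omega
        · have := hb x hx
          omega
      · simp at hl
  · obtain ⟨rfl, hz⟩ := List.append_inj' (show [x, y, z] ++ [t] = l ++ [m] from hl) rfl
    obtain rfl : t = m := by simpa using hz
    have := hm y (hs'.subset (by simp))
    omega

theorem Avoids312.lt_of_mem (h : Avoids312 (α ++ a :: b :: β)) (hbβ : b ∉ β) :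
    ∀ e ∈ β, e < a → e < b := by
  intro e he hea
  by_contra heb
  have hne : e ≠ b := by
    rintro rfl
    exact hbβ he
  exact h a b e ((((List.singleton_sublist.2 he).cons_cons b).cons_cons a).trans
    (List.sublist_append_right _ _)) ⟨by omega, hea⟩

/-- Let `x > b > y` with `x`, `y` in `α`. If `x` comes first, `x y b` is a `312`; otherwise `y x a
b` is a `1342`. -/
theorem forall_lt_or_forall_gt_of_avoids (h : Avoids312 (α ++ a :: b :: β))
    (h' : Avoids1342 (α ++ a :: b :: β)) (hα : ∀ x ∈ α, x < a) (hba : b < a) (hbα : b ∉ α) :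
    (∀ x ∈ α, x < b) ∨ ∀ x ∈ α, b < x := by
  by_contra hcon
  push Not at hcon
  obtain ⟨⟨x, hx, hbx⟩, y, hy, hyb⟩ := hcon
  have hxb : x ≠ b := by
    rintro rfl
    exact hbα hx
  have hyb' : y ≠ b := by
    rintro rfl
    exact hbα hy
  rcases pair_sublist hx hy (by omega) with hs | hs
  · exact h x y b (hs.append (show [b].Sublist (a :: b :: β) by simp)) ⟨by omega, by omega⟩
  · exact h' y x a b (hs.append (show [a, b].Sublist (a :: b :: β) by simp))
      ⟨by omega, by omega, hα x hx⟩

/-- Removing the partner of the highest point from a tight word that avoids `312`. -/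
theorem TightSorted.erase (h1 : TightSorted (α ++ [a])) (h2 : TightSorted (b :: β)) (hba : b < a)
    (hav : Avoids312 (α ++ a :: b :: β)) (haβ : a ∉ β) : TightSorted (α ++ a :: β) := by
  -- The decomposition of `b β` into joins is kept, with its leftmost single letter `b` replaced by
  -- `α a`.
  suffices ∀ w, TightSorted w → ∀ b β, w = b :: β → b < a → Avoids312 (α ++ a :: b :: β) → a ∉ β →
      TightSorted (α ++ a :: β) from this _ h2 _ _ rfl hba hav haβ
  clear h2 hba hav haβ
  intro w hw
  induction hw with
  | single x =>
    rintro b β ⟨⟩ - - -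
    exact h1
  | @join α₂ a₂ b₂ β₂ m₂ e1 e2 hba₂ hm₂ ih1 _ =>
    intro b β hw hba hav haβ
    -- Otherwise `a b m₂` would be a `312`.
    have ham : a < m₂ := by
      by_contra hlt
      have hmβ : m₂ ∈ b :: β := hw ▸ (by simp)
      have hbm : b < m₂ := by
        cases α₂ with
        | nil =>
          obtain rfl : a₂ = b := by simpa using congrArg List.head? hw
          exact hm₂ _ (by simp)
        | cons c α₂ =>
          obtain rfl : c = b := by simpa using congrArg List.head? hw
          exact hm₂ _ (by simp)
      have hmβ : m₂ ∈ β := (List.mem_cons.1 hmβ).resolve_left hbm.ne'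
      have hne : m₂ ≠ a := by
        rintro rfl
        exact haβ hmβ
      exact hav a b m₂ ((((List.singleton_sublist.2 hmβ).cons_cons b).cons_cons a).trans
        (List.sublist_append_right _ _)) ⟨hbm, by omega⟩
    have hαm : ∀ x ∈ α, x < m₂ := fun x hx => (h1.lt_last x hx).trans ham
    cases α₂ with
    | nil =>
      simp only [List.nil_append, List.cons_append, List.cons.injEq] at hw
      obtain ⟨rfl, rfl⟩ := hw
      have := join (m := m₂) h1 e2 (hba₂.trans hba) fun x hx => by
        rcases List.mem_append.1 hx with hx | hx
        · exact hαm x hx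
        rcases List.mem_cons.1 hx with rfl | hx
        · exact ham
        · exact hm₂ x (by simpa using Or.inr (List.mem_cons.1 hx))
      simpa using this
    | cons c α₂ =>
      simp only [List.cons_append, List.cons.injEq] at hw
      obtain ⟨rfl, rfl⟩ := hw
      have h3 := ih1 c (α₂ ++ [a₂]) (by simp) hba (hav.sublist (by simp)) fun h => haβ (by
        rcases List.mem_append.1 h with h | h
        · exact List.mem_append_left _ (List.mem_append_left _ h)
        · simp [List.mem_singleton.1 h])
      have := join (α := α ++ a :: α₂) (m := m₂) (by simpa using h3) e2 hba₂ fun x hx => by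
        rw [List.append_assoc] at hx
        rcases List.mem_append.1 hx with hx | hx
        · exact hαm x hx
        rcases List.mem_cons.1 hx with rfl | hx
        · exact ham
        · exact hm₂ x (List.mem_cons_of_mem _ hx)
      simpa using this

/-- The word formed by the partner and the letters after a balanced prefix is tight. -/
theorem TightSorted.cons_of_balanced_prefix {w : List ℕ} (hw : TightSorted w)
    (hv : w = α ++ a :: β) (hα : Balanced (α ++ [a])) (hba : b < a)
    (hβ : ∀ e ∈ β, e < a → e < b) : TightSorted (b :: β) := by
  induction hw generalizing β with
  | single x =>
    have hlen := congrArg List.length hv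
    simp only [List.length_append, List.length_cons, List.length_nil] at hlen
    obtain rfl : β = [] := List.eq_nil_of_length_eq_zero (by omega)
    exact single b
  | @join α₁ a₁ b₁ β₁ m e1 e2 hba₁ hm ih1 _ =>
    rcases List.eq_nil_or_concat' β with rfl | ⟨β', m', rfl⟩
    · exact single b
    have hp : α ++ [a] <+: α₁ ++ a₁ :: b₁ :: β₁ ++ [m] := ⟨β' ++ [m'], by rw [hv]; simp⟩
    have hv' : α₁ ++ a₁ :: b₁ :: β₁ = α ++ a :: β' := by
      have : α₁ ++ a₁ :: b₁ :: β₁ ++ [m] = (α ++ a :: β') ++ [m'] := by rw [hv]; simp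
      exact (List.append_inj' this rfl).1
    obtain rfl : m = m' := by
      have : α₁ ++ a₁ :: b₁ :: β₁ ++ [m] = (α ++ a :: β') ++ [m'] := by rw [hv]; simp
      simpa using (List.append_inj' this rfl).2
    have ham : a < m := hm a (by rw [hv']; simp)
    rcases prefix_of_balanced e1 e2 hba₁ hp hα with h | ⟨γ, hγ⟩
    · rw [hv] at h
      have := congrArg List.length h
      simp at this
    · have hβ' : β' = γ ++ b₁ :: β₁ := by
        rw [append_cons_cons_eq, ← hγ] at hv'
        simpa using hv'.symm
      subst hβ'
      -- `γ` is the rest of the left factor after `α a`. If it is empty, the descent `a b₁` turns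
      -- into `b b₁`, a descent by `hβ`; otherwise the induction hypothesis replaces `α a` inside
      -- the left factor.
      rcases List.eq_nil_or_concat' γ with rfl | ⟨γ, c, rfl⟩
      · rw [List.append_nil] at hγ
        obtain ⟨rfl, h⟩ := List.append_inj' hγ rfl
        obtain rfl : a = a₁ := by simpa using h
        have := join (α := []) (m := m) (single b) e2 (hβ b₁ (by simp) hba₁) fun x hx => by
          rcases List.mem_cons.1 hx with rfl | hx
          · omega
          · exact hm x (List.mem_append_right _ (List.mem_cons_of_mem _ hx))
        simpa using this
      · rw [← List.append_assoc] at hγ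
        obtain ⟨rfl, h⟩ := List.append_inj' hγ rfl
        obtain rfl : c = a₁ := by simpa using h
        have h3 := ih1 (β := γ ++ [c]) (by simp) fun e he => hβ e (by
          rcases List.mem_append.1 he with he | he
          · simp [he]
          · simp [List.mem_singleton.1 he])
        have := join (α := b :: γ) (m := m) (by simpa using h3) e2 hba₁ fun x hx => by
          rw [List.cons_append] at hx
          rcases List.mem_cons.1 hx with rfl | hx
          · omega
          · refine hm x ?_
            rw [hv']
            refine List.mem_append_right _ (List.mem_cons_of_mem _ ?_)
            simpa using hx
        simpa using this

end Insert

/-! ### Sites of a permutation -/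

/-- The site `(p, c)`: a new letter can be placed behind the balanced prefix `u` of length `p`, just
below the last letter of `u` if `c = 0`, and below all letters of `u` if `c = 1`. -/
def IsPermSite (w : List ℕ) (p c : ℕ) : Prop :=
  p ≤ w.length ∧ Balanced (w.take p) ∧ (c = 0 ∨ (c = 1 ∧ 1 < p ∧
    ∀ e ∈ w.drop p, (∀ x ∈ w.take p, e < x) ∨ ∀ x ∈ w.take p, x < e))

/-- The finite set of sites of a word. -/
noncomputable def permSites (w : List ℕ) : Finset (ℕ ×ₗ ℕ) := by
  classical exact ((Finset.range (w.length + 1) ×ˢ Finset.range 2).filter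
    fun s => IsPermSite w s.1 s.2).map toLex.toEmbedding

theorem mem_permSites {w : List ℕ} {p c : ℕ} : toLex (p, c) ∈ permSites w ↔ IsPermSite w p c := by
  classical
  simp only [permSites, Finset.mem_map_equiv, Finset.mem_filter, Finset.mem_product,
    Finset.mem_range, toLex_symm_eq, ofLex_toLex]
  refine ⟨fun h => h.2, fun h => ⟨⟨by have := h.1; omega, ?_⟩, h⟩⟩
  rcases h.2.2 with h | h <;> omega

theorem permSites_map {f : ℕ → ℕ} (hf : StrictMono f) (w : List ℕ) :
    permSites (w.map f) = permSites w := by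
  ext s
  obtain ⟨⟨p, c⟩, rfl⟩ := toLex.surjective s
  rw [mem_permSites, mem_permSites, IsPermSite, IsPermSite, ← List.map_take, ← List.map_drop,
    Balanced, Balanced, desCount_map fun x _ y _ => hf.lt_iff_lt]
  simp only [List.length_map, List.forall_mem_map, hf.lt_iff_lt]

/-- The conditions on the letters of a word `α a b β m` in a child of `α a β`. -/
structure IsHookSplit (α : List ℕ) (a b : ℕ) (β : List ℕ) (m : ℕ) : Prop where
  left : TightSorted (α ++ [a])
  right : TightSorted (b :: β)
  lt : b < a
  lt_max : ∀ x ∈ α ++ a :: b :: β, x < m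

theorem TightSorted.exists_isHookSplit {w : List ℕ} (h : TightSorted w) (hl : w.length ≠ 1) :
    ∃ α a b β m, w = α ++ a :: b :: β ++ [m] ∧ IsHookSplit α a b β m := by
  cases h with
  | single x => exact absurd rfl hl
  | join h1 h2 hba hm => exact ⟨_, _, _, _, _, rfl, h1, h2, hba, hm⟩

theorem IsHookSplit.tightSorted {α : List ℕ} {a b : ℕ} {β : List ℕ} {m : ℕ}
    (h : IsHookSplit α a b β m) : TightSorted (α ++ a :: b :: β ++ [m]) :=
  TightSorted.join h.left h.right h.lt h.lt_max

/-- `c` is the type of the site that produces the letter `b` behind the prefix `α a`. -/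
def IsSiteKind (α : List ℕ) (b c : ℕ) : Prop :=
  (c = 0 ∧ ∀ x ∈ α, x < b) ∨ (c = 1 ∧ α ≠ [] ∧ ∀ x ∈ α, b < x)

section Sites

variable {α β : List ℕ} {a b m c : ℕ}

/-- Every letter of `β` is below `b` or above `a`; if `b` is below `α`, this puts it below or above
the whole prefix `α a`. -/
theorem isPermSite_of_isHookSplit (h : IsHookSplit α a b β m) (hβ : ∀ e ∈ β, e < a → e < b)
    (haβ : a ∉ β) (hc : IsSiteKind α b c) : IsPermSite (α ++ a :: β) (α.length + 1) c := by
  have hsplit : α ++ a :: β = (α ++ [a]) ++ β := by simp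
  have hlen : (α ++ [a]).length = α.length + 1 := by simp
  have ht : (α ++ a :: β).take (α.length + 1) = α ++ [a] := by
    rw [hsplit, ← hlen, List.take_left]
  have hd : (α ++ a :: β).drop (α.length + 1) = β := by
    rw [hsplit, ← hlen, List.drop_left]
  rw [IsPermSite, ht, hd]
  refine ⟨by simp, h.left.balanced, ?_⟩
  rcases hc with ⟨rfl, -⟩ | ⟨rfl, hne, hlt⟩
  · exact Or.inl rfl
  · refine Or.inr ⟨rfl, ?_, fun e he => ?_⟩
    · have := List.length_pos_of_ne_nil hne
      omega
    · by_cases hea : e < a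
      · left
        intro x hx
        have h1 := hβ e he hea
        rcases List.mem_append.1 hx with hx | hx
        · exact h1.trans (hlt x hx)
        · rwa [List.mem_singleton.1 hx]
      · right
        intro x hx
        have hne : a ≠ e := by
          rintro rfl
          exact haβ he
        rcases List.mem_append.1 hx with hx | hx
        · have := h.left.lt_last x hx
          omega
        · rw [List.mem_singleton.1 hx]
          omega

/-- Sites behind a prefix shorter than `α a` are unaffected, since `b` and `m` do not separate
letters of `α`. Behind `α a` the choice `1` survives only for `c = 1`: for `c = 0` either `α` is
empty or `b` separates `α` from `a`. Behind the whole word both choices exist because no letter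
follows. -/
theorem isPermSite_join_iff (h : IsHookSplit α a b β m) (hβ : ∀ e ∈ β, e < a → e < b)
    (haβ : a ∉ β) (hc : IsSiteKind α b c) (p d : ℕ) :
    IsPermSite (α ++ a :: b :: β ++ [m]) p d ↔
      (IsPermSite (α ++ a :: β) p d ∧ (p < α.length + 1 ∨ p = α.length + 1 ∧ d < c)) ∨
      (p = α.length + 1 ∧ d = c) ∨
      (p = (α ++ a :: b :: β ++ [m]).length ∧ (d = 0 ∨ d = 1)) := by
  have hw : (α ++ a :: b :: β ++ [m]).length = α.length + β.length + 3 := by simp; omega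
  have hq : (α ++ [a]).length = α.length + 1 := by simp
  have s1 : α ++ a :: b :: β ++ [m] = (α ++ [a]) ++ (b :: β ++ [m]) := by simp
  have s2 : α ++ a :: β = (α ++ [a]) ++ β := by simp
  have t1 : ∀ p ≤ α.length + 1, (α ++ a :: b :: β ++ [m]).take p = (α ++ [a]).take p := by
    intro p hp
    rw [s1, List.take_append_of_le_length (by omega)]
  have t2 : ∀ p ≤ α.length + 1, (α ++ a :: β).take p = (α ++ [a]).take p := by
    intro p hp
    rw [s2, List.take_append_of_le_length (by omega)]
  have d1 : ∀ p ≤ α.length + 1, (α ++ a :: b :: β ++ [m]).drop p =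
      (α ++ [a]).drop p ++ (b :: β ++ [m]) := by
    intro p hp
    rw [s1, List.drop_append_of_le_length (by omega)]
  have d2 : ∀ p ≤ α.length + 1, (α ++ a :: β).drop p = (α ++ [a]).drop p ++ β := by
    intro p hp
    rw [s2, List.drop_append_of_le_length (by omega)]
  have tq : (α ++ [a]).take (α.length + 1) = α ++ [a] := by rw [← hq, List.take_length]
  have dq : (α ++ [a]).drop (α.length + 1) = [] := by rw [← hq, List.drop_length]
  have hm' : ∀ x ∈ α ++ [a], x < m := fun x hx => h.lt_max x (by
    rw [append_cons_cons_eq]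
    exact List.mem_append_left _ hx)
  have hlt : ∀ p < α.length + 1,
      (IsPermSite (α ++ a :: b :: β ++ [m]) p d ↔ IsPermSite (α ++ a :: β) p d) := by
    intro p hp
    have hsub : ∀ x ∈ (α ++ [a]).take p, x ∈ α := by
      intro x hx
      rw [List.take_append_of_le_length (by omega)] at hx
      exact List.mem_of_mem_take hx
    rw [IsPermSite, IsPermSite, t1 p hp.le, t2 p hp.le, d1 p hp.le, d2 p hp.le]
    refine and_congr ⟨fun _ => by simp; omega, fun _ => by omega⟩ (and_congr_right fun _ =>
      or_congr_right (and_congr_right fun _ => and_congr_right fun _ => ?_))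
    constructor
    · intro h1 e he
      refine h1 e ?_
      rcases List.mem_append.1 he with he | he
      · exact List.mem_append_left _ he
      · simp [he]
    · intro h1 e he
      rcases List.mem_append.1 he with he | he
      · exact h1 e (List.mem_append_left _ he)
      rcases List.mem_append.1 he with he | he
      · rcases List.mem_cons.1 he with rfl | he
        · rcases hc with ⟨-, hc⟩ | ⟨-, -, hc⟩
          · exact Or.inr fun x hx => hc x (hsub x hx)
          · exact Or.inl fun x hx => hc x (hsub x hx)
        · exact h1 e (List.mem_append_right _ he)
      · obtain rfl := List.mem_singleton.1 he
        exact Or.inr fun x hx => hm' x (List.mem_append_left _ (hsub x hx))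
  have hv := isPermSite_of_isHookSplit h hβ haβ hc
  have hbal : Balanced (α ++ [a]) := h.left.balanced
  have hc01 : c = 0 ∨ c = 1 := by
    rcases hc with hc | hc
    · exact Or.inl hc.1
    · exact Or.inr hc.1
  have hv0 : IsPermSite (α ++ a :: β) (α.length + 1) 0 := ⟨hv.1, hv.2.1, Or.inl rfl⟩
  have hw0 : IsPermSite (α ++ a :: b :: β ++ [m]) (α.length + 1) 0 :=
    ⟨by omega, by rw [t1 _ le_rfl, tq]; exact hbal, Or.inl rfl⟩
  have hw1 : IsPermSite (α ++ a :: b :: β ++ [m]) (α.length + 1) 1 ↔ c = 1 := by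
    rw [IsPermSite, t1 _ le_rfl, tq, d1 _ le_rfl, dq, List.nil_append]
    constructor
    · rintro ⟨-, -, h1 | ⟨-, h1, h2⟩⟩
      · omega
      · rcases hc with ⟨-, hc⟩ | hc
        · have hne : α ≠ [] := by
            rintro rfl
            simp at h1
          obtain ⟨x, hx⟩ := List.exists_mem_of_ne_nil α hne
          have h3 := hc x hx
          have hlt := h.lt
          rcases h2 b (by simp) with h2 | h2
          · have := h2 x (by simp [hx])
            omega
          · have := h2 a (by simp)
            omega
        · exact hc.1
    · rintro rfl
      refine ⟨by omega, hbal, Or.inr ⟨rfl, ?_, ?_⟩⟩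
      · rcases hv.2.2 with h1 | h1
        · omega
        · exact h1.2.1
      · have hbl : ∀ x ∈ α ++ [a], b < x := by
          intro x hx
          rcases List.mem_append.1 hx with hx | hx
          · rcases hc with hc | hc
            · omega
            · exact hc.2.2 x hx
          · rw [List.mem_singleton.1 hx]
            exact h.lt
        intro e he
        rcases List.mem_append.1 he with he | he
        · rcases List.mem_cons.1 he with rfl | he
          · exact Or.inl hbl
          · rcases hv.2.2 with h1 | ⟨-, -, h1⟩
            · omega
            · rw [t2 _ le_rfl, tq, d2 _ le_rfl, dq, List.nil_append] at h1
              exact h1 e he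
        · obtain rfl := List.mem_singleton.1 he
          exact Or.inr hm'
  have hq' : IsPermSite (α ++ a :: b :: β ++ [m]) (α.length + 1) d → d = 0 ∨ d = 1 := by
    rintro ⟨-, -, h1 | h1⟩
    · exact Or.inl h1
    · exact Or.inr h1.1
  constructor
  · intro hs
    rcases TightSorted.prefix_of_balanced h.left h.right h.lt (List.take_prefix p _) hs.2.1 with
      h1 | h1
    · have h2 := congrArg List.length h1
      rw [List.length_take, hw] at h2
      have h3 := hs.1
      refine Or.inr (Or.inr ⟨by omega, ?_⟩)
      rcases hs.2.2 with h4 | h4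
      · exact Or.inl h4
      · exact Or.inr h4.1
    · have h2 := h1.length_le
      have h3 := hs.1
      rw [List.length_take, hq, min_eq_left h3] at h2
      rcases h2.lt_or_eq with h2 | rfl
      · exact Or.inl ⟨(hlt p h2).1 hs, Or.inl h2⟩
      · rcases hq' hs with rfl | rfl
        · rcases hc01 with rfl | rfl
          · exact Or.inr (Or.inl ⟨rfl, rfl⟩)
          · exact Or.inl ⟨hv0, Or.inr ⟨rfl, by omega⟩⟩
        · exact Or.inr (Or.inl ⟨rfl, (hw1.1 hs).symm⟩)
  · rintro (⟨h1, h2 | ⟨rfl, h2⟩⟩ | ⟨rfl, rfl⟩ | ⟨rfl, hd⟩)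
    · exact (hlt p h2).2 h1
    · obtain rfl : d = 0 := by omega
      exact hw0
    · rcases hc01 with rfl | rfl
      · exact hw0
      · exact hw1.2 rfl
    · refine ⟨le_rfl, by rw [List.take_length]; exact h.tightSorted.balanced, ?_⟩
      rcases hd with rfl | rfl
      · exact Or.inl rfl
      · exact Or.inr ⟨rfl, by omega, by simp⟩

theorem card_permSites_join (h : IsHookSplit α a b β m) (hβ : ∀ e ∈ β, e < a → e < b)
    (haβ : a ∉ β) (hc : IsSiteKind α b c) :
    (permSites (α ++ a :: b :: β ++ [m])).card =
      3 + ((permSites (α ++ a :: β)).filter (· < toLex (α.length + 1, c))).card := by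
  classical
  have hw : (α ++ a :: b :: β ++ [m]).length = α.length + β.length + 3 := by simp; omega
  have hset : permSites (α ++ a :: b :: β ++ [m]) =
      (permSites (α ++ a :: β)).filter (· < toLex (α.length + 1, c)) ∪
      {toLex (α.length + 1, c), toLex (α.length + β.length + 3, 0),
        toLex (α.length + β.length + 3, 1)} := by
    ext s
    obtain ⟨⟨p, d⟩, rfl⟩ := toLex.surjective s
    rw [mem_permSites, isPermSite_join_iff h hβ haβ hc, hw, Finset.mem_union, Finset.mem_filter,
      mem_permSites, Prod.Lex.toLex_lt_toLex]
    simp only [Finset.mem_insert, Finset.mem_singleton, EmbeddingLike.apply_eq_iff_eq,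
      Prod.mk.injEq]
    tauto
  rw [hset, Finset.card_union_of_disjoint, add_comm]
  · congr 1
    rw [Finset.card_insert_of_notMem, Finset.card_insert_of_notMem, Finset.card_singleton]
    · simp
    · simp only [Finset.mem_insert, Finset.mem_singleton, EmbeddingLike.apply_eq_iff_eq,
        Prod.mk.injEq]
      omega
  · rw [Finset.disjoint_left]
    intro s hs hs'
    obtain ⟨⟨p, d⟩, rfl⟩ := toLex.surjective s
    have := (Finset.mem_filter.1 hs).2
    rw [Prod.Lex.toLex_lt_toLex] at this
    simp only [Finset.mem_insert, Finset.mem_singleton, EmbeddingLike.apply_eq_iff_eq,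
      Prod.mk.injEq] at hs' this
    omega

end Sites

/-! ### The generating tree of the uniquely sorted permutations -/

/-- Length `0` is excluded because the empty word has fertility `1` without being tight. -/
theorem mem_uniquelySortedAvoiding_iff {n : ℕ} {w : List ℕ} (hn : n ≠ 0) :
    w ∈ uniquelySortedAvoiding n {[3, 1, 2], [1, 3, 4, 2]} ↔
      w ∈ symm n ∧ TightSorted w ∧ Avoids312 w ∧ Avoids1342 w := by
  rw [uniquelySortedAvoiding, Set.mem_ofPred_eq]
  refine and_congr_right fun hw => and_congr ⟨fun h => ?_, fun h => ?_⟩ ?_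
  · refine tightSorted_of_fertility_eq_one h ?_
    rintro rfl
    exact hn (length_of_mem_symm hw).symm
  · exact h.fertility_eq_one (isPermWord_of_mem_symm hw)
  · rw [← not_containsPattern_312_iff, ← not_containsPattern_1342_iff]
    simp

/-- The increasing map that leaves out the value `b`. -/
def skip (b x : ℕ) : ℕ := if x < b then x else x + 1

theorem strictMono_skip (b : ℕ) : StrictMono (skip b) := by
  intro x y h
  unfold skip
  split_ifs <;> omega

theorem skip_spec (b x : ℕ) : (x < b ∧ skip b x = x) ∨ (b ≤ x ∧ skip b x = x + 1) := by
  unfold skip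
  split_ifs with h
  · exact Or.inl ⟨h, rfl⟩
  · exact Or.inr ⟨by omega, rfl⟩

/-- Insert the value `b` behind the first `p` letters of `w` and append the letter `m`. -/
def insertPair (w : List ℕ) (p b m : ℕ) : List ℕ :=
  (w.take p).map (skip b) ++ b :: (w.drop p).map (skip b) ++ [m]

/-- The letter `b` that the site `(p, c)` inserts. -/
def IsSiteValue (w : List ℕ) (p c b : ℕ) : Prop :=
  b ∈ w.take p ∧ (c = 0 → ∀ x ∈ w.take p, x ≤ b) ∧ (c = 1 → ∀ x ∈ w.take p, b ≤ x)

theorem exists_isSiteValue {w : List ℕ} {p c : ℕ} (hs : IsPermSite w p c) :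
    ∃ b, IsSiteValue w p c b := by
  have hne : w.take p ≠ [] := by
    intro h
    have := hs.2.1
    rw [h] at this
    simp [Balanced] at this
  rcases hs.2.2 with rfl | ⟨rfl, -⟩
  · cases hm : (w.take p).max? with
    | none => exact absurd (List.max?_eq_none_iff.1 hm) hne
    | some b =>
      obtain ⟨h1, h2⟩ := List.max?_eq_some_iff.1 hm
      exact ⟨b, h1, fun _ => h2, by simp⟩
  · cases hm : (w.take p).min? with
    | none => exact absurd (List.min?_eq_none_iff.1 hm) hne
    | some b =>
      obtain ⟨h1, h2⟩ := List.min?_eq_some_iff.1 hm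
      exact ⟨b, h1, by simp, fun _ => h2⟩

theorem IsSiteValue.unique {w : List ℕ} {p c b b' : ℕ} (hc : c = 0 ∨ c = 1)
    (h : IsSiteValue w p c b) (h' : IsSiteValue w p c b') : b = b' := by
  rcases hc with rfl | rfl
  · exact le_antisymm (h'.2.1 rfl b h.1) (h.2.1 rfl b' h'.1)
  · exact le_antisymm (h.2.2 rfl b' h'.1) (h'.2.2 rfl b h.1)

/-- The structure of the word that arises from `w` by inserting at a site. -/
theorem exists_insertPair_eq {n p c b : ℕ} {w : List ℕ} (hw : w ∈ symm n) (ht : TightSorted w)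
    (hs : IsPermSite w p c) (hb : IsSiteValue w p c b) :
    ∃ α a β, insertPair w p b (n + 2) = α ++ a :: b :: β ++ [n + 2] ∧
      α ++ a :: β = w.map (skip b) ∧ α.length + 1 = p ∧ IsHookSplit α a b β (n + 2) ∧
      (∀ e ∈ β, e < a → e < b) ∧ a ∉ β ∧ IsSiteKind α b c := by
  obtain ⟨hnd, hmem⟩ := mem_symm_iff.1 hw
  have htake : TightSorted (w.take p) := ht.of_balanced_prefix (List.take_prefix p w) hs.2.1
  obtain ⟨α₀, a₀, hα₀, hlast⟩ := htake.exists_last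
  have hwsplit : w = α₀ ++ a₀ :: w.drop p := by
    conv_lhs => rw [← List.take_append_drop p w, hα₀]
    simp
  have hlen : α₀.length + 1 = p := by
    have := congrArg List.length hα₀
    rw [List.length_take, min_eq_left hs.1] at this
    simpa using this.symm
  -- The letter `b` of `w` is an extreme letter of the prefix and is raised to `b + 1` by `skip b`;
  -- the inserted `b` therefore comes just below it.
  obtain ⟨hbm, hb0, hb1⟩ := hb
  have hs2 := hs.2.2
  rw [hα₀] at hbm hb0 hb1 hs2
  have hmono := strictMono_skip b
  have hba₀ : b ≤ a₀ := by
    rcases List.mem_append.1 hbm with h | h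
    · exact (hlast b h).le
    · exact (List.mem_singleton.1 h).le
  have hsa : skip b a₀ = a₀ + 1 := by
    rcases skip_spec b a₀ with h | h <;> omega
  have hnd' := hnd
  rw [hwsplit, List.nodup_append, List.nodup_cons] at hnd'
  have hmap : α₀.map (skip b) ++ skip b a₀ :: (w.drop p).map (skip b) = w.map (skip b) := by
    conv_rhs => rw [hwsplit]
    simp
  have haβ : skip b a₀ ∉ (w.drop p).map (skip b) := by
    rw [List.mem_map_of_injective hmono.injective]
    exact hnd'.2.1.1
  have hkind : IsSiteKind (α₀.map (skip b)) b c := by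
    rcases hs2 with rfl | ⟨rfl, hp, -⟩
    · refine Or.inl ⟨rfl, fun x hx => ?_⟩
      obtain ⟨y, hy, rfl⟩ := List.mem_map.1 hx
      have h1 := hb0 rfl a₀ (by simp)
      have h2 := hlast y hy
      rcases skip_spec b y with h | h <;> omega
    · refine Or.inr ⟨rfl, ?_, fun x hx => ?_⟩
      · rw [Ne, List.map_eq_nil_iff]
        rintro rfl
        simp at hlen
        omega
      · obtain ⟨y, hy, rfl⟩ := List.mem_map.1 hx
        have h1 := hb1 rfl y (by simp [hy])
        rcases skip_spec b y with h | h <;> omega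
  have hβ : ∀ e ∈ (w.drop p).map (skip b), e < skip b a₀ → e < b := by
    intro e he hea
    obtain ⟨y, hy, rfl⟩ := List.mem_map.1 he
    have hya : y < a₀ := hmono.lt_iff_lt.1 hea
    have hyb : y < b := by
      rcases hs2 with rfl | ⟨rfl, -, h1⟩
      · have := hb0 rfl a₀ (by simp)
        omega
      · rcases h1 y hy with h1 | h1
        · exact h1 b hbm
        · have := h1 a₀ (by simp)
          omega
    rcases skip_spec b y with h | h <;> omega
  have hba : b < skip b a₀ := by omega
  have hle : ∀ x ∈ w, skip b x ≤ n + 1 := by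
    intro x hx
    have := (hmem x).1 hx
    rcases skip_spec b x with h | h <;> omega
  have hbn : b ≤ n := ((hmem b).1 (List.mem_of_mem_take (i := p) (hα₀ ▸ hbm))).2
  refine ⟨α₀.map (skip b), skip b a₀, (w.drop p).map (skip b), ?_, hmap, by simpa using hlen,
    ⟨?_, ?_, hba, ?_⟩, hβ, haβ, hkind⟩
  · rw [insertPair, hα₀]
    simp
  · have := htake.map (f := skip b) fun x _ y _ => hmono.lt_iff_lt
    rw [hα₀] at this
    simpa using this
  · refine (ht.map (f := skip b) fun x _ y _ => hmono.lt_iff_lt).cons_of_balanced_prefix hmap.symm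
      ?_ hba hβ
    have := hs.2.1
    rw [Balanced] at this ⊢
    rw [← desCount_map (f := skip b) (fun x _ y _ => hmono.lt_iff_lt), hα₀] at this
    simpa using this
  · intro x hx
    have : x = b ∨ x ∈ w.map (skip b) := by
      rw [← hmap]
      simp only [List.mem_append, List.mem_cons] at hx ⊢
      tauto
    rcases this with rfl | hx
    · omega
    · obtain ⟨y, hy, rfl⟩ := List.mem_map.1 hx
      have := hle y hy
      omega

theorem insertPair_mem {k p c b : ℕ} (π : U k) (hs : IsPermSite π.1 p c)
    (hb : IsSiteValue π.1 p c b) :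
    insertPair π.1 p b (2 * k + 1 + 2) ∈
      uniquelySortedAvoiding (2 * (k + 1) + 1) {[3, 1, 2], [1, 3, 4, 2]} := by
  obtain ⟨w, hw⟩ := π
  rw [mem_uniquelySortedAvoiding_iff (by omega)] at hw ⊢
  obtain ⟨hw, ht, h312, h1342⟩ := hw
  obtain ⟨hnd, hmem⟩ := mem_symm_iff.1 hw
  obtain ⟨α, a, β, heq, hmap, hlen, hsplit, hβ, haβ, hkind⟩ := exists_insertPair_eq hw ht hs hb
  have hmono := strictMono_skip b
  rw [← Avoids312.map_iff hmono, ← hmap] at h312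
  rw [← Avoids1342.map_iff hmono, ← hmap] at h1342
  have hbα : (∀ x ∈ α, x < b) ∨ ∀ x ∈ α, b < x := hkind.imp (·.2) (·.2.2)
  have hbn := (hmem b).1 (List.mem_of_mem_take hb.1)
  have hskip : ∀ x, x ∈ w.map (skip b) ↔ (1 ≤ x ∧ x ≤ 2 * k + 2) ∧ x ≠ b := by
    intro x
    rw [List.mem_map]
    constructor
    · rintro ⟨y, hy, rfl⟩
      have := (hmem y).1 hy
      rcases skip_spec b y with h | h <;> omega
    · rintro ⟨hx, hxb⟩
      by_cases hlt : x < b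
      · refine ⟨x, (hmem x).2 (by omega), ?_⟩
        rcases skip_spec b x with h | h <;> omega
      · refine ⟨x - 1, (hmem _).2 (by omega), ?_⟩
        rcases skip_spec b (x - 1) with h | h <;> omega
  have hnd' : (α ++ a :: β).Nodup := hmap ▸ hnd.map hmono.injective
  have hperm : (α ++ a :: b :: β ++ [2 * k + 1 + 2]).Perm
      ((2 * k + 1 + 2) :: b :: (α ++ a :: β)) := by
    refine (List.perm_append_singleton _ _).trans (List.Perm.cons _ ?_)
    rw [append_cons_cons_eq]
    refine List.perm_middle.trans ?_
    simp
  rw [heq]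
  refine ⟨mem_symm_iff.2 ⟨hperm.nodup_iff.2 ?_, fun x => ?_⟩, hsplit.tightSorted,
    h312.insert hsplit.left.lt_last hsplit.lt hβ hbα hsplit.lt_max,
    h1342.insert hsplit.left.lt_last hsplit.lt hβ haβ hbα hsplit.lt_max⟩
  · rw [List.nodup_cons, List.nodup_cons, List.mem_cons, hmap, hskip, hskip, ← hmap]
    exact ⟨by omega, by omega, hnd'⟩
  · rw [hperm.mem_iff, List.mem_cons, List.mem_cons, hmap, hskip]
    omega

/-- Removing the highest point and its partner. -/
theorem exists_parent_word {n : ℕ} {α : List ℕ} {a b : ℕ} {β : List ℕ} {m : ℕ}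
    (hw : α ++ a :: b :: β ++ [m] ∈ symm (n + 2)) (h : IsHookSplit α a b β m)
    (h312 : Avoids312 (α ++ a :: b :: β)) (h1342 : Avoids1342 (α ++ a :: b :: β)) :
    ∃ w ∈ symm n, normalize (α ++ a :: β) = w ∧ α ++ a :: β = w.map (skip b) ∧ m = n + 2 ∧
      TightSorted w ∧ Avoids312 w ∧ Avoids1342 w ∧ (∀ e ∈ β, e < a → e < b) ∧ a ∉ β ∧
      ∃ c, IsSiteKind α b c := by
  obtain ⟨hnd, hmem⟩ := mem_symm_iff.1 hw
  have hperm : (α ++ a :: b :: β ++ [m]).Perm (m :: b :: (α ++ a :: β)) := by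
    refine (List.perm_append_singleton _ _).trans (List.Perm.cons _ ?_)
    rw [append_cons_cons_eq]
    refine List.perm_middle.trans ?_
    simp
  have hnd' := hperm.nodup_iff.1 hnd
  rw [List.nodup_cons, List.nodup_cons] at hnd'
  obtain ⟨hm1, hb1, hnd'⟩ := hnd'
  have hm : m = n + 2 := by
    have h1 := (hmem (n + 2)).2 (by omega)
    have h2 := (hmem m).1 (by simp)
    rcases List.mem_append.1 h1 with h1 | h1
    · have := h.lt_max _ h1
      omega
    · exact (List.mem_singleton.1 h1).symm
  have hmem' : ∀ x, x ∈ α ++ a :: β ↔ (1 ≤ x ∧ x ≤ n + 1) ∧ x ≠ b := by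
    intro x
    have h1 := hmem x
    rw [hperm.mem_iff, List.mem_cons, List.mem_cons] at h1
    constructor
    · intro hx
      have h2 := h1.1 (Or.inr (Or.inr hx))
      have h3 : x ≠ b := by
        rintro rfl
        exact hb1 hx
      have h4 : x ≠ m := by
        rintro rfl
        exact hm1 (List.mem_cons_of_mem _ hx)
      omega
    · rintro ⟨hx, hxb⟩
      rcases h1.2 (by omega) with h2 | h2 | h2
      · omega
      · omega
      · exact h2
  have hbn := (hmem b).1 (by simp)
  have hbm := h.lt_max b (by simp)
  have hmono := strictMono_skip b
  -- `g` closes the gap that the value `b` leaves; off `b` it inverts `skip b`.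
  obtain ⟨g, hg⟩ : ∃ g : ℕ → ℕ, ∀ x, (x < b ∧ g x = x) ∨ (b ≤ x ∧ g x = x - 1) :=
    ⟨fun x => if x < b then x else x - 1, fun x => by
      by_cases hx : x < b
      · exact Or.inl ⟨hx, if_pos hx⟩
      · exact Or.inr ⟨by omega, if_neg hx⟩⟩
  have hgm : ∀ x ∈ α ++ a :: β, ∀ y ∈ α ++ a :: β, (g x < g y ↔ x < y) := by
    intro x hx y hy
    have := (hmem' x).1 hx
    have := (hmem' y).1 hy
    have := hg x
    have := hg y
    omega
  have hskip : ∀ x ∈ α ++ a :: β, skip b (g x) = x := by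
    intro x hx
    have := (hmem' x).1 hx
    have := hg x
    have := skip_spec b (g x)
    omega
  have hmap : α ++ a :: β = ((α ++ a :: β).map g).map (skip b) := by
    rw [List.map_map]
    conv_lhs => rw [← List.map_id (α ++ a :: β)]
    exact List.map_congr_left fun x hx => (hskip x hx).symm
  have hw₀ : (α ++ a :: β).map g ∈ symm n := by
    refine mem_symm_iff.2 ⟨hnd'.map_on fun x hx y hy hxy => ?_, fun x => ?_⟩
    · rw [← hskip x hx, hxy, hskip y hy]
    · rw [List.mem_map]
      constructor
      · rintro ⟨y, hy, rfl⟩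
        have := (hmem' y).1 hy
        have := hg y
        omega
      · intro hx
        have h1 := skip_spec b x
        have h2 := hg (skip b x)
        exact ⟨skip b x, (hmem' _).2 (by omega), by omega⟩
  have hnd'' := hnd.sublist (List.sublist_append_left _ _)
  rw [List.nodup_append, List.nodup_cons, List.nodup_cons] at hnd''
  have haβ : a ∉ β := fun h => hnd''.2.1.1 (List.mem_cons_of_mem _ h)
  have hbα : b ∉ α := fun h => hb1 (List.mem_append_left _ h)
  have hsub : (α ++ a :: β).Sublist (α ++ a :: b :: β) := by simp
  refine ⟨(α ++ a :: β).map g, hw₀, ?_, hmap, hm,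
    (h.left.erase h.right h.lt h312 haβ).map hgm, ?_, ?_, h312.lt_of_mem hnd''.2.1.2.1, haβ, ?_⟩
  · conv_lhs => rw [hmap]
    rw [normalize_map hmono, normalize_eq_self hw₀]
  · rw [← Avoids312.map_iff hmono, ← hmap]
    exact h312.sublist hsub
  · rw [← Avoids1342.map_iff hmono, ← hmap]
    exact h1342.sublist hsub
  · by_cases hlt : ∀ x ∈ α, x < b
    · exact ⟨0, Or.inl ⟨rfl, hlt⟩⟩
    · refine ⟨1, Or.inr ⟨rfl, ?_, ?_⟩⟩
      · rintro rfl
        simp at hlt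
      · exact (forall_lt_or_forall_gt_of_avoids h312 h1342 h.left.lt_last h.lt hbα).resolve_left hlt

/-- The partner of the highest point is the letter that belongs to its site. -/
theorem isSiteValue_of_map_skip {n : ℕ} {α : List ℕ} {a b : ℕ} {β : List ℕ} {c : ℕ} {w : List ℕ}
    (hw : w ∈ symm n) (h : IsHookSplit α a b β (n + 2)) (hb : 1 ≤ b)
    (hmap : α ++ a :: β = w.map (skip b)) (hβ : ∀ e ∈ β, e < a → e < b) (haβ : a ∉ β)
    (hc : IsSiteKind α b c) : IsSiteValue w (α.length + 1) c b := by
  obtain ⟨hnd, hmem⟩ := mem_symm_iff.1 hw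
  have hmono := strictMono_skip b
  have htake : (w.take (α.length + 1)).map (skip b) = α ++ [a] := by
    rw [List.map_take, ← hmap]
    have : α ++ a :: β = (α ++ [a]) ++ β := by simp
    rw [this, List.take_append_of_le_length (by simp)]
    exact List.take_of_length_le (by simp)
  have hba := h.lt
  have ham := h.lt_max a (by simp)
  have hsb : skip b b = b + 1 := by rcases skip_spec b b with h | h <;> omega
  have hbw : b + 1 ∈ α ++ a :: β := by
    rw [hmap, ← hsb]
    exact List.mem_map_of_mem ((hmem b).2 (by omega))
  -- A letter `b + 1` in `β` would be below `a` and hence, by `hβ`, below `b`. So the letter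
  -- directly above the gap lies in the prefix.
  have hbαa : b + 1 ∈ α ++ [a] := by
    rcases List.mem_append.1 hbw with h1 | h1
    · exact List.mem_append_left _ h1
    rcases List.mem_cons.1 h1 with h1 | h1
    · simp [h1]
    · have hne : b + 1 ≠ a := by
        intro h2
        exact haβ (h2 ▸ h1)
      have := hβ _ h1 (by omega)
      omega
  have hin : ∀ x ∈ w.take (α.length + 1), skip b x ∈ α ++ [a] := by
    intro x hx
    rw [← htake]
    exact List.mem_map_of_mem hx
  refine ⟨?_, ?_, ?_⟩
  · rwa [← List.mem_map_of_injective hmono.injective, htake, hsb]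
  · rintro rfl x hx
    obtain ⟨-, hc⟩ := hc.resolve_right (by simp)
    have h1 := skip_spec b x
    rcases List.mem_append.1 (hin x hx) with h2 | h2
    · have := hc _ h2
      omega
    · rw [List.mem_singleton] at h2
      rcases List.mem_append.1 hbαa with h3 | h3
      · have := hc _ h3
        omega
      · rw [List.mem_singleton] at h3
        omega
  · rintro rfl x hx
    obtain ⟨-, -, hc⟩ := hc.resolve_left (by simp)
    have h1 := skip_spec b x
    rcases List.mem_append.1 (hin x hx) with h2 | h2
    · have := hc _ h2
      omega
    · rw [List.mem_singleton] at h2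
      omega

theorem insertPair_eq_of_map_skip {α : List ℕ} {a b : ℕ} {β : List ℕ} {m : ℕ} {w : List ℕ}
    (hmap : α ++ a :: β = w.map (skip b)) :
    insertPair w (α.length + 1) b m = α ++ a :: b :: β ++ [m] := by
  have h1 : α ++ a :: β = (α ++ [a]) ++ β := by simp
  have hlen : (α ++ [a]).length = α.length + 1 := by simp
  rw [insertPair, List.map_take, List.map_drop, ← hmap, h1, ← hlen, List.take_left, List.drop_left]
  simp

theorem U.exists_split (y : U (k + 1)) : ∃ α a b β m, y.1 = α ++ a :: b :: β ++ [m] ∧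
    α ++ a :: b :: β ++ [m] ∈ symm (2 * k + 1 + 2) ∧ IsHookSplit α a b β m ∧
    Avoids312 (α ++ a :: b :: β) ∧ Avoids1342 (α ++ a :: b :: β) := by
  obtain ⟨w, hw⟩ := y
  rw [mem_uniquelySortedAvoiding_iff (by omega)] at hw
  obtain ⟨hs, ht, h1, h2⟩ := hw
  have hlen := length_of_mem_symm hs
  obtain ⟨α, a, b, β, m, rfl, h⟩ := ht.exists_isHookSplit (by omega)
  exact ⟨α, a, b, β, m, rfl, hs, h, h1.sublist (List.sublist_append_left _ _),
    h2.sublist (List.sublist_append_left _ _)⟩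

theorem existsUnique_permGenerates (y : U (k + 1)) : ∃! x : U k, permGenerates k x y := by
  obtain ⟨α, a, b, β, m, hy, hs, h, h312, h1342⟩ := y.exists_split
  obtain ⟨w, hw, hnorm, -, -, ht, hw1, hw2, -⟩ := exists_parent_word hs h h312 h1342
  have hgen : ∀ x : U k, permGenerates k x y ↔ x.1 = w := by
    intro x
    rw [permGenerates, hy, wordGenerates_join_iff h.left h.right h.lt h.lt_max, hnorm]
  refine ⟨⟨w, (mem_uniquelySortedAvoiding_iff (by omega)).2 ⟨hw, ht, hw1, hw2⟩⟩, (hgen _).2 rfl,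
    fun x hx => Subtype.ext ((hgen x).1 hx)⟩

theorem exists_permChild (x : U k) (s : permSites x.1) : ∃ y : U (k + 1), ∃ b,
    IsSiteValue x.1 (ofLex s.1).1 (ofLex s.1).2 b ∧
      y.1 = insertPair x.1 (ofLex s.1).1 b (2 * k + 1 + 2) := by
  have hs := mem_permSites.1 s.2
  obtain ⟨b, hb⟩ := exists_isSiteValue hs
  exact ⟨⟨_, insertPair_mem x hs hb⟩, b, hb, rfl⟩

theorem isLabelTree_U : IsLabelTree U permGenerates := by
  refine IsLabelTree.of_sites (fun _ x => permSites x.1) ?_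
    (fun n y => existsUnique_permGenerates y) ?_
  · have h1 : [1] ∈ uniquelySortedAvoiding (2 * 0 + 1) {[3, 1, 2], [1, 3, 4, 2]} := by
      rw [mem_uniquelySortedAvoiding_iff (by omega)]
      refine ⟨List.Perm.refl _, TightSorted.single 1, fun x y z hs => ?_, fun x y z t hs => ?_⟩
      · have := hs.length_le
        simp at this
      · have := hs.length_le
        simp at this
    refine ⟨⟨[1], h1⟩, fun x => Subtype.ext ?_, ?_⟩
    · have : x.1.Perm [1] := x.2.1
      exact List.perm_singleton.1 this
    · rw [Finset.card_eq_one]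
      -- The choice `1` needs a prefix of more than one letter, so `[1]` has a single site.
      refine ⟨toLex (1, 0), ?_⟩
      ext s
      obtain ⟨⟨p, c⟩, rfl⟩ := toLex.surjective s
      rw [mem_permSites, Finset.mem_singleton, EmbeddingLike.apply_eq_iff_eq, Prod.mk.injEq]
      constructor
      · rintro ⟨h2, h3, h4⟩
        simp only [List.length_singleton] at h2
        have hp : p ≠ 0 := by
          rintro rfl
          simp [Balanced] at h3
        omega
      · rintro ⟨rfl, rfl⟩
        exact ⟨le_rfl, by simp [Balanced, desCount], Or.inl rfl⟩
  · intro n x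
    obtain ⟨hx, ht, -⟩ := (mem_uniquelySortedAvoiding_iff (by omega)).1 x.2
    choose c b hb hc using exists_permChild x
    have hsite : ∀ s : permSites x.1, IsPermSite x.1 (ofLex s.1).1 (ofLex s.1).2 :=
      fun s => mem_permSites.1 s.2
    have hspec := fun s => exists_insertPair_eq hx ht (hsite s) (hb s)
    choose α a β heq hmap hlen hsplit hβ haβ hkind using hspec
    refine ⟨c, ?_, ?_, ?_⟩
    · intro s t hst
      have h1 := hc s
      rw [hst, hc t, heq, heq] at h1
      obtain ⟨e1, -, e2, -⟩ := TightSorted.split_unique (hsplit t).left (hsplit t).right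
        (hsplit t).lt (hsplit s).left (hsplit s).right (hsplit s).lt (List.append_inj' h1 rfl).1
      have hp : (ofLex s.1).1 = (ofLex t.1).1 := by rw [← hlen s, ← hlen t, e1]
      -- The choice can be read off from the child: kind `1` requires a nonempty `α` above `b`,
      -- which is incompatible with `α` below `b`.
      have hd : (ofLex s.1).2 = (ofLex t.1).2 := by
        have k1 := hkind s
        have k2 := hkind t
        rw [← e1, ← e2] at k1
        rcases k1 with ⟨k1, k3⟩ | ⟨k1, k4, k3⟩ <;> rcases k2 with ⟨k2, k5⟩ | ⟨k2, k6, k5⟩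
        · omega
        · obtain ⟨z, hz⟩ := List.exists_mem_of_ne_nil _ k6
          have := k3 z hz
          have := k5 z hz
          omega
        · obtain ⟨z, hz⟩ := List.exists_mem_of_ne_nil _ k4
          have := k3 z hz
          have := k5 z hz
          omega
        · omega
      exact Subtype.ext (Prod.ext hp hd)
    · intro y
      constructor
      · intro hxy
        obtain ⟨α', a', b', β', m, hy, hs, h, h312, h1342⟩ := y.exists_split
        obtain ⟨w, hw, hnorm, hmap', rfl, -, -, -, hβ', haβ', d, hd⟩ :=
          exists_parent_word hs h h312 h1342
        rw [permGenerates, hy, wordGenerates_join_iff h.left h.right h.lt h.lt_max, hnorm] at hxy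
        subst hxy
        have hb1 : 1 ≤ b' := (((mem_symm_iff.1 hs).2 b').1 (by simp)).1
        have hs' := isPermSite_of_isHookSplit h hβ' haβ' hd
        have hmem : toLex (α'.length + 1, d) ∈ permSites x.1 := by
          -- Sites depend only on relative order, so they can be tested on `α' a' β'` before
          -- normalization.
          rw [← permSites_map (strictMono_skip b'), ← hmap', mem_permSites]
          exact hs'
        have hval := isSiteValue_of_map_skip hw h hb1 hmap' hβ' haβ' hd
        refine ⟨⟨_, hmem⟩, Subtype.ext ?_⟩
        have hbu := (hb ⟨_, hmem⟩).unique (by rcases hd with hd | hd <;> simp [hd.1]) hval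
        rw [hc, hbu, hy]
        exact insertPair_eq_of_map_skip hmap'
      · rintro ⟨s, rfl⟩
        have h := hsplit s
        rw [permGenerates, hc, heq, wordGenerates_join_iff h.left h.right h.lt h.lt_max, hmap,
          normalize_map (strictMono_skip _), normalize_eq_self hx]
    · intro s
      rw [hc, heq, card_permSites_join (hsplit s) (hβ s) (haβ s) (hkind s), hmap,
        permSites_map (strictMono_skip _), hlen]
      rfl

end CatalanIntervals

theorem theorem5 :
    (∃ Υ : ∀ k : ℕ, CatalanIntervals.U k ≃ CatalanIntervals.IntNC k,
      ∀ (k : ℕ) (π : CatalanIntervals.U k) (π' : CatalanIntervals.U (k + 1)),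
        CatalanIntervals.permGenerates k π π' ↔
          CatalanIntervals.intervalGenerates k (Υ k π) (Υ (k + 1) π')) ∧
    CatalanIntervals.HasGeneratingTree CatalanIntervals.U CatalanIntervals.permGenerates
      {3} (fun m => (Finset.Icc 3 (m + 2)).val) ∧
    CatalanIntervals.HasGeneratingTree CatalanIntervals.IntNC CatalanIntervals.intervalGenerates
      {3} (fun m => (Finset.Icc 3 (m + 2)).val) :=
  ⟨CatalanIntervals.isLabelTree_U.exists_equiv CatalanIntervals.isLabelTree_intNC,
    CatalanIntervals.isLabelTree_U.hasGeneratingTree,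
    CatalanIntervals.isLabelTree_intNC.hasGeneratingTree⟩
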